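/- Notation. $B_1(0)\subset\mathbb{R}^2$ is the open unit ball; $\operatorname{Sym}_{2\times2}$ is the space of real symmetric $2\times 2$ matrices (with the Frobenius norm). For a finite-dimensional normed space $F$, $C_c^\infty(B_1(0);F)$ is the space of smooth functions $\mathbb{R}^2\to F$ whose support is a compact subset of $B_1(0)$, and $C_0^\infty(\mathbb{T}^2;F)$ is the space of smooth functions $\mathbb{R}^2\to F$ that are $1$-periodic in both variables and satisfy $\int_{[0,1]^2}u\,dx=0$. Write $\|u\|_{L^1(\mathbb{T}^2)}=\int_{[0,1]^2}|u|\,dx$, $\|f\|_{W^{1,\infty}}=\|f\|_{L^\infty}+\|\nabla f\|_{L^\infty}$, $u_\lambda(x)=u(\lambda x)$, and $(\operatorname{div}A)_i=\sum_j\partial_jA_{ij}$. Fix $\iota\in C_c^\infty(B_1(0);\mathbb{R})$ and $\eta\in C_c^\infty(B_1(0);\mathbb{R}^2)$ with $\int\iota=1$, $\int x_1\iota=\int x_2\iota=0$, $\int\eta=0$, $\int (x_1\eta_2-x_2\eta_1)=1$, and for $g\in C_c^\infty(B_1(0);\mathbb{R}^2)$ put $$\mathbb{P}_Xg=g-\iota\int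 g\,dx-\eta\int (x_1g_2-x_2g_1)\,dx .$$ A torus antidivergence is a linear operator $\operatorname{div}^{-1}_{\mathbb{T}^2}:C_0^\infty(\mathbb{T}^2;\mathbb{R}^2)\to C_0^\infty(\mathbb{T}^2;\operatorname{Sym}_{2\times 2})$ with $\operatorname{div}\operatorname{div}^{-1}_{\mathbb{T}^2}u=u$ for all $u$. Lemma (Improved antidivergence operators). (0) There exist a torus antidivergence and a constant $K\ge 0$ such that $$\|\operatorname{div}^{-1}_{\mathbb{T}^2}u_\lambda\|_{L^1(\mathbb{T}^2)}\le \frac{K}{\lambda}\|u\|_{L^1(\mathbb{T}^2)}\qquad\text{for all } u\in C_0^\infty(\mathbb{T}^2;\mathbb{R}^2) \text{ and all integers }\lambda\ge1. \tag{$*$}$$ Moreover there is a constant $C>0$, depending only on $\iota$ and $\eta$, such that for every torus antidivergence $\operatorname{div}^{-1}_{\mathbb{T}^2}$ the following hold. (i) There is a bilinear operator $\mathcal{R}:C_c^\infty(B_1(0);\mathbb{R})\times C_0^\infty(\mathbb{T}^2;\mathbb{R}^2)\to C_c^\infty(B_1(0);\operatorname{Sym}_{2\times2})$ with $$\operatorname{div}\mathcal{R}(f,u)=\mathbb{P}_X(fu),\qquad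 \|\mathcal{R}(f,u)\|_{L^1(\mathbb{R}^2)}\le C\|f\|_{W^{1,\infty}}\|\operatorname{div}^{-1}_{\mathbb{T}^2}u\|_{L^1(\mathbb{T}^2)}$$ for all $f,u$. If $(*)$ holds with constant $K\ge0$, then $\|\mathcal{R}(f,u_\lambda)\|_{L^1(\mathbb{R}^2)}\le \frac{CK}{\lambda}\|f\|_{W^{1,\infty}}\|u\|_{L^1(\mathbb{T}^2)}$ for all $f,u$ and integers $\lambda\ge1$. (ii) There is a bilinear operator $\tilde{\mathcal{R}}:C_c^\infty(B_1(0);\mathbb{R}^2)\times C_0^\infty(\mathbb{T}^2;\operatorname{Sym}_{2\times2})\to C_c^\infty(B_1(0);\operatorname{Sym}_{2\times2})$ with $$\operatorname{div}\tilde{\mathcal{R}}(f,T)=\mathbb{P}_X(Tf),\qquad \|\tilde{\mathcal{R}}(f,T)\|_{L^1(\mathbb{R}^2)}\le C\|f\|_{W^{1,\infty}}\sum_{k=1,2}\|\operatorname{div}^{-1}_{\mathbb{T}^2}(Te_k)\|_{L^1(\mathbb{T}^2)}$$ for all $f,T$. If $(*)$ holds with constant $K\ge0$, then $\|\tilde{\mathcal{R}}(f,T_\lambda)\|_{L^1(\mathbb{R}^2)}\le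 \frac{CK}{\lambda}\|f\|_{W^{1,\infty}}\|T\|_{L^1(\mathbb{T}^2)}$ for all $f,T$ and integers $\lambda\ge1$. -/

import Mathlib

open MeasureTheory Set
open scoped ContDiff Matrix

attribute [local instance] Matrix.frobeniusNormedAddCommGroup Matrix.frobeniusNormedSpace

/-- The Euclidean plane. -/
abbrev Plane : Type := EuclideanSpace ℝ (Fin 2)

/-- The standard basis vectors of the plane. -/
noncomputable abbrev stdVec (k : Fin 2) : Plane := EuclideanSpace.single k (1 : ℝ)

/-- The space of real symmetric `2 × 2` matrices, with the Frobenius norm. -/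
def SymMat : Submodule ℝ (Matrix (Fin 2) (Fin 2) ℝ) where
  carrier := {A | A.IsSymm}
  add_mem' hA hB := Matrix.IsSymm.add hA hB
  zero_mem' := Matrix.isSymm_zero
  smul_mem' c _ hA := Matrix.IsSymm.smul hA c

/-- The `k`-th column `A e_k` of a symmetric matrix, as a continuous linear map. -/
noncomputable def symCol (k : Fin 2) : SymMat →L[ℝ] Plane :=
  LinearMap.toContinuousLinearMap
    { toFun := fun A => WithLp.toLp 2 (fun i => A.1 i k)
      map_add' := fun _ _ => rfl
      map_smul' := fun _ _ => rfl }

section Spaces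

variable (F : Type*) [NormedAddCommGroup F] [NormedSpace ℝ F]

/-- `C_c^∞(B₁(0); F)`: smooth functions on the plane whose support is a compact subset of the
open unit ball. -/
def SmoothBall : Submodule ℝ (Plane → F) where
  carrier := {f | ContDiff ℝ ∞ f ∧ HasCompactSupport f ∧ tsupport f ⊆ Metric.ball 0 1}
  add_mem' hf hg := ⟨hf.1.add hg.1, hf.2.1.add hg.2.1,
    (tsupport_add _ _).trans (union_subset hf.2.2 hg.2.2)⟩
  zero_mem' := ⟨contDiff_const, HasCompactSupport.zero, by simp [tsupport]⟩
  smul_mem' c _ hf := ⟨contDiff_const.smul hf.1, hf.2.1.smul_left (f := fun _ => c),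
    (closure_mono (Function.support_const_smul_subset c _)).trans hf.2.2⟩

/-- One periodic box. -/
def unitCell : Set Plane := {x | ∀ i, x i ∈ Icc (0 : ℝ) 1}

theorem isCompact_unitCell : IsCompact unitCell := by
  have h : unitCell = (EuclideanSpace.equiv (Fin 2) ℝ).toHomeomorph ⁻¹'
      (Set.pi univ fun _ => Icc (0 : ℝ) 1) := by
    ext x; simp [unitCell]
    exact ⟨fun h => ⟨fun i => by fin_cases i; exacts [h.1.1, h.2.1], fun i => by fin_cases i; exacts [h.1.2, h.2.2]⟩,
      fun h => ⟨⟨h.1 0, h.2 0⟩, h.1 1, h.2 1⟩⟩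
  rw [h]
  exact (Homeomorph.isCompact_preimage _).2 (isCompact_univ_pi fun _ => isCompact_Icc)

variable {F} in
theorem integrableOn_unitCell {f : Plane → F} (hf : ContDiff ℝ ∞ f) :
    IntegrableOn f unitCell :=
  hf.continuous.continuousOn.integrableOn_compact isCompact_unitCell

/-- `C_0^∞(𝕋²; F)`: smooth functions on the plane that have period one in both variables and
vanishing mean over one periodic box. -/
noncomputable def SmoothTorus : Submodule ℝ (Plane → F) where
  carrier := {u | ContDiff ℝ ∞ u ∧ (∀ (k : Fin 2) (l : ℤ) (x : Plane),
    u (x + (l : ℝ) • stdVec k) = u x) ∧ ∫ x in unitCell, u x = 0}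
  add_mem' := by
    rintro f g ⟨hf, hf', hf''⟩ ⟨hg, hg', hg''⟩
    refine ⟨hf.add hg, fun k l x => by simp only [Pi.add_apply, hf', hg'], ?_⟩
    have := integral_add (integrableOn_unitCell hf) (integrableOn_unitCell hg)
    simpa [hf'', hg''] using this
  zero_mem' := ⟨contDiff_const, fun _ _ _ => rfl, by simp⟩
  smul_mem' := by
    rintro c f ⟨hf, hf', hf''⟩
    refine ⟨contDiff_const.smul hf, fun k l x => by simp only [Pi.smul_apply, hf'], ?_⟩
    have := integral_smul (μ := volume.restrict unitCell) c f
    simpa [hf''] using this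

end Spaces

section Operations

variable {F G : Type*} [NormedAddCommGroup F] [NormedSpace ℝ F]
  [NormedAddCommGroup G] [NormedSpace ℝ G]

/-- Pointwise application of a continuous linear map to a mean-zero periodic function. -/
noncomputable def mapTorus [CompleteSpace F] [CompleteSpace G] (L : F →L[ℝ] G) (u : SmoothTorus F) : SmoothTorus G :=
  ⟨fun x => L (u.1 x), L.contDiff.comp u.2.1, fun k l x => by simp only [u.2.2.1], by
    rw [L.integral_comp_comm (integrableOn_unitCell u.2.1), u.2.2.2, map_zero]⟩

theorem integral_unitCell (f : Plane → F) (hf : Continuous f) :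
    ∫ x in unitCell, f x = ∫ s in (0 : ℝ)..1, ∫ t in (0 : ℝ)..1, f !₂[s, t] := by
  let e : (ℝ × ℝ) ≃ᵐ (Fin 2 → ℝ) := MeasurableEquiv.finTwoArrow.symm
  let e' : (ℝ × ℝ) ≃ᵐ Plane := e.trans (MeasurableEquiv.toLp 2 (Fin 2 → ℝ))
  have hmp : MeasurePreserving e' :=
    (PiLp.volume_preserving_toLp (Fin 2)).comp (volume_preserving_finTwoArrow ℝ).symm
  have hpre : e' ⁻¹' unitCell = Icc (0 : ℝ) 1 ×ˢ Icc (0 : ℝ) 1 := by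
    ext p
    simp [e', e, unitCell, Fin.forall_fin_two, MeasurableEquiv.finTwoArrow,
      MeasurableEquiv.piFinTwo, Prod.le_def]
    tauto
  have hval : ∀ p : ℝ × ℝ, e' p = !₂[p.1, p.2] := fun p => rfl
  have hcont : Continuous fun p : ℝ × ℝ => f !₂[p.1, p.2] := by
    refine hf.comp ((PiLp.continuous_toLp 2 _).comp ?_)
    refine continuous_pi fun i => ?_
    fin_cases i
    · exact continuous_fst
    · exact continuous_snd
  rw [← hmp.setIntegral_preimage_emb e'.measurableEmbedding, hpre, Measure.volume_eq_prod,
    setIntegral_prod]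
  · simp only [hval]
    rw [intervalIntegral.integral_of_le zero_le_one, integral_Icc_eq_integral_Ioc]
    refine integral_congr_ae (Filter.Eventually.of_forall fun s => ?_)
    simp only
    rw [intervalIntegral.integral_of_le zero_le_one, integral_Icc_eq_integral_Ioc]
  · simp only [hval]
    exact hcont.continuousOn.integrableOn_compact (isCompact_Icc.prod isCompact_Icc)

theorem integral_dilate_periodic (g : ℝ → F) (hc : Continuous g)
    (hg : Function.Periodic g 1) (n : ℕ+) :
    ∫ t in (0 : ℝ)..1, g ((n : ℝ) * t) = ∫ t in (0 : ℝ)..1, g t := by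
  have hn : (n : ℝ) ≠ 0 := by exact_mod_cast n.ne_zero
  rw [intervalIntegral.integral_comp_mul_left g hn]
  have h := hg.intervalIntegral_add_zsmul_eq (n : ℤ) 0
    fun a b => hc.intervalIntegrable a b
  simp only [zero_add, zsmul_eq_mul, mul_one, Int.cast_natCast] at h
  rw [mul_zero, mul_one, h, natCast_zsmul, ← Nat.cast_smul_eq_nsmul ℝ, smul_smul, inv_mul_cancel₀ hn, one_smul]

/-- The fast oscillating function `u_λ(x) = u(λ x)`, for an integer `λ ≥ 1`. -/
noncomputable def oscillate (n : ℕ+) (u : SmoothTorus F) : SmoothTorus F :=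
  ⟨fun x => u.1 ((n : ℝ) • x), u.2.1.comp (contDiff_const_smul (n : ℝ)), fun k l x => by
    have := u.2.2.1 k ((n : ℤ) * l) ((n : ℝ) • x)
    simp only [smul_add, smul_smul]
    push_cast at this
    exact this, by
    have hc : Continuous u.1 := u.2.1.continuous
    have hper : ∀ s t : ℝ, u.1 !₂[s, t + 1] = u.1 !₂[s, t] := fun s t => by
      rw [← u.2.2.1 1 1 !₂[s, t]]
      refine congrArg u.1 ?_
      ext i; fin_cases i <;> simp
    have hper' : ∀ s t : ℝ, u.1 !₂[s + 1, t] = u.1 !₂[s, t] := fun s t => by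
      rw [← u.2.2.1 0 1 !₂[s, t]]
      refine congrArg u.1 ?_
      ext i; fin_cases i <;> simp
    have hsm : ∀ s t : ℝ, (n : ℝ) • (!₂[s, t] : Plane) = !₂[(n : ℝ) * s, (n : ℝ) * t] :=
      fun s t => by ext i; fin_cases i <;> simp
    have hcp : ∀ a : ℝ, Continuous fun t => u.1 !₂[a, t] := fun a => by
      refine hc.comp ((PiLp.continuous_toLp 2 _).comp (continuous_pi fun i => ?_))
      fin_cases i
      exacts [continuous_const, continuous_id]
    have hcu : Continuous (Function.uncurry fun s t : ℝ => u.1 !₂[s, t]) := by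
      refine hc.comp ((PiLp.continuous_toLp 2 _).comp (continuous_pi fun i => ?_))
      fin_cases i
      exacts [continuous_fst, continuous_snd]
    change ∫ x in unitCell, (u.1 ∘ fun x => (n : ℝ) • x) x = 0
    rw [integral_unitCell _ (hc.comp (continuous_const_smul (n : ℝ)))]
    simp only [Function.comp, hsm]
    have h1 : ∀ s : ℝ, ∫ t in (0 : ℝ)..1, u.1 !₂[(n : ℝ) * s, (n : ℝ) * t] =
        ∫ t in (0 : ℝ)..1, u.1 !₂[(n : ℝ) * s, t] := fun s =>
      integral_dilate_periodic (fun t => u.1 !₂[(n : ℝ) * s, t]) (hcp _) (hper _) n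
    simp only [h1]
    rw [integral_dilate_periodic (fun s => ∫ t in (0 : ℝ)..1, u.1 !₂[s, t])
      (intervalIntegral.continuous_parametric_intervalIntegral_of_continuous' hcu 0 1)
      (fun s => by simp only [hper']) n, ← integral_unitCell _ hc, u.2.2.2]⟩

end Operations

section Norms

variable {F : Type*} [NormedAddCommGroup F] [NormedSpace ℝ F]

/-- `‖f‖_{L¹(ℝ²)}`. -/
noncomputable def normL1Plane (f : Plane → F) : ℝ := ∫ x, ‖f x‖

/-- `‖u‖_{L¹(𝕋²)}`, the integral over one periodic box. -/
noncomputable def normL1Torus (u : Plane → F) : ℝ := ∫ x in unitCell, ‖u x‖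

/-- `‖f‖_{W^{1,∞}(ℝ²)} = ‖f‖_{L^∞} + ‖∇f‖_{L^∞}`, for functions in `C_c^∞`. -/
noncomputable def normW1Inf (f : Plane → F) : ℝ :=
  (eLpNorm f ⊤ volume).toReal + (eLpNorm (fderiv ℝ f) ⊤ volume).toReal

end Norms

/-- Row-wise divergence of a symmetric matrix field: `(div A)_i = ∑_j ∂_j A_{ij}`. -/
noncomputable def matDiv (A : Plane → SymMat) (x : Plane) : Plane :=
  WithLp.toLp 2 fun i => ∑ j, fderiv ℝ (fun y => (A y).1 i j) x (stdVec j)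

/-- Angular momentum `∫ (x₁ f₂ - x₂ f₁) dx` of a vector field. -/
noncomputable def angularMomentum (f : Plane → Plane) : ℝ :=
  ∫ x : Plane, (x 0 * f x 1 - x 1 * f x 0)

/-- `ι` has unit mass and vanishing first moments; `η` has zero linear momentum and unit angular
momentum. -/
structure IsMomentumPair (ι : SmoothBall ℝ) (η : SmoothBall Plane) : Prop where
  mass : ∫ x : Plane, ι.1 x = 1
  moment : ∀ i : Fin 2, ∫ x : Plane, x i * ι.1 x = 0
  linear : ∫ x : Plane, η.1 x = 0
  angular : angularMomentum η.1 = 1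

/-- `ℙ_X f = f - ι ∫ f - η ∫ (x₁ f₂ - x₂ f₁)`: the projection onto the fields with vanishing
linear and angular momentum that is determined by `ι` and `η`. -/
noncomputable def momentumProj (ι : SmoothBall ℝ) (η : SmoothBall Plane)
    (f : Plane → Plane) (x : Plane) : Plane :=
  f x - ι.1 x • (∫ y, f y) - angularMomentum f • η.1 x

/-- The product `T f` of a symmetric matrix field and a vector field. -/
noncomputable def matMulVec (T : Plane → SymMat) (f : Plane → Plane) (x : Plane) : Plane :=
  WithLp.toLp 2 ((T x).1 *ᵥ (f x).ofLp)

/-- Linear operators `C_0^∞(𝕋²; ℝ²) → C_0^∞(𝕋²; Sym)`. -/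
abbrev TorusOperator : Type := SmoothTorus Plane →ₗ[ℝ] SmoothTorus SymMat

/-- `D` is an antidivergence operator on the torus: `div (D u) = u`. -/
def IsTorusAntidivergence (D : TorusOperator) : Prop :=
  ∀ u : SmoothTorus Plane, matDiv (D u).1 = u.1

/-- `‖D u_λ‖_{L¹(𝕋²)} ≤ (K / λ) ‖u‖_{L¹(𝕋²)}` for all `u` and all integers `λ ≥ 1`, with a constant
`K ≥ 0`. -/
def HasOscillationBound (D : TorusOperator) (K : ℝ) : Prop :=
  0 ≤ K ∧ ∀ (n : ℕ+) (u : SmoothTorus Plane),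
    normL1Torus (D (oscillate n u)).1 ≤ K / (n : ℝ) * normL1Torus u.1

/-! On the torus, let `M_k h` be the mean of `h` along `e_k` and `P_k h` the average of `h(x + r
e_k)` with weight `r - 1/2`, so that `∂_k P_k h = h - M_k h` (`fderiv_dirPrim`). The symmetric field
with diagonal `P_1 u_1`, `P_2 u_2` and off-diagonal entry `P_2 M_1 u_1 + P_1 M_2 u_2` has divergence
`u`, because the only remainder is a full mean, which is zero. The operators `M_k`, `P_k` do not
increase the `L¹` norm, and `P_k h_λ = λ⁻¹ (P_k h)_λ` exactly (`dirPrim_dilate`). This yields `(*)`.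

In the ball, let `D` be any torus antidivergence. Then `div (f Du) = f u + (Du)∇f`. The left side is
the divergence of a compactly supported symmetric field, hence has no linear or angular momentum and
is fixed by `ℙ_X`. Therefore `ℙ_X (f u) = div (f Du) - ℙ_X ((Du)∇f)`, and `R(f,u) = f Du - S ℙ_X
((Du)∇f)` works as soon as `S` inverts the symmetric divergence on momentum-free fields
(`matDiv_ballAntidiv`). Derivatives fall only on `f`, so `‖Du‖` in `L¹` suffices if `S` is bounded
on `L¹`.

The operator `S` is an explicit average over segments, `Sg(x) = ι(x) ∫ y ⊗ g - ∫ w ⊗ w ∫₀¹ ∇ι(x - s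
w) · g(x + (1 - s) w) ds dw`. Applying `w · ∇` to the inner integral leaves only its endpoint values
`∇ι(x) · g(x + w) - ∇ι(x - w) · g(x)` (`fderiv_segKernel`). Integrated against `w_i`, the first
becomes `∑_k ∂_kι ∫ y_i g_k` and is cancelled by the divergence of the first summand of `S`; the
second becomes `g_i` by integration by parts and `∫ ι = 1`. Convexity keeps the support in the ball,
and Fubini with translation invariance gives the `L¹` bound (`normL1Plane_segSolution_le`).

Part (ii) follows from part (i) by writing `T f = ∑_k f_k T e_k`. -/

/-! ### Differentiation of parameter integrals over compact sets -/

theorem hasFDerivAt_left_of_uncurry {E P G : Type*} [NormedAddCommGroup E] [NormedSpace ℝ E]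
    [NormedAddCommGroup P] [NormedSpace ℝ P] [NormedAddCommGroup G] [NormedSpace ℝ G]
    {Φ : E → P → G} (hΦ : ContDiff ℝ ∞ (Function.uncurry Φ)) (q : P) (x : E) :
    HasFDerivAt (fun x => Φ x q)
      ((fderiv ℝ (Function.uncurry Φ) (x, q)).comp (ContinuousLinearMap.inl ℝ E P)) x :=
  HasFDerivAt.comp (g := Function.uncurry Φ) (f := fun e => (e, q)) x
    (hΦ.differentiable (by simp) _).hasFDerivAt (hasFDerivAt_prodMk_left x q)

theorem contDiff_uncurry_fderiv_left {E P G : Type*} [NormedAddCommGroup E] [NormedSpace ℝ E]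
    [NormedAddCommGroup P] [NormedSpace ℝ P] [NormedAddCommGroup G] [NormedSpace ℝ G]
    {Φ : E → P → G} (hΦ : ContDiff ℝ ∞ (Function.uncurry Φ)) :
    ContDiff ℝ ∞ (Function.uncurry fun x q => fderiv ℝ (fun x => Φ x q) x) := by
  simp only [Function.uncurry_def, fun q x => (hasFDerivAt_left_of_uncurry hΦ q x).fderiv]
  exact (hΦ.fderiv_right (m := ∞) (by simp)).clm_comp contDiff_const

theorem hasFDerivAt_setIntegral_of_contDiff {E P G : Type*}
    [NormedAddCommGroup E] [NormedSpace ℝ E] [ProperSpace E]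
    [NormedAddCommGroup P] [NormedSpace ℝ P] [MeasurableSpace P] [OpensMeasurableSpace P]
    [SecondCountableTopology P] [NormedAddCommGroup G] [NormedSpace ℝ G]
    {μ : Measure P} [IsFiniteMeasureOnCompacts μ] {K : Set P} (hK : IsCompact K)
    {Φ : E → P → G} (hΦ : ContDiff ℝ ∞ (Function.uncurry Φ)) (x₀ : E) :
    HasFDerivAt (fun x => ∫ q in K, Φ x q ∂μ)
      (∫ q in K, fderiv ℝ (fun x => Φ x q) x₀ ∂μ) x₀ := by
  have hd := hasFDerivAt_left_of_uncurry hΦ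
  have hcont := (contDiff_uncurry_fderiv_left hΦ).continuous
  obtain ⟨C, hC⟩ := ((isCompact_closedBall x₀ 1).prod hK).exists_bound_of_continuousOn
    hcont.continuousOn
  refine hasFDerivAt_integral_of_dominated_of_fderiv_le (bound := fun _ => C)
    (F' := fun x q => fderiv ℝ (fun x => Φ x q) x)
    (Metric.closedBall_mem_nhds x₀ one_pos) ?_ ?_ ?_ ?_ ?_ ?_
  · refine Filter.Eventually.of_forall fun x => ?_
    exact (hΦ.continuous.comp (by fun_prop : Continuous fun q : P => (x, q))).aestronglyMeasurable
  · exact (hΦ.continuous.comp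
      (by fun_prop : Continuous fun q : P => (x₀, q))).continuousOn.integrableOn_compact hK
  · exact (hcont.comp (by fun_prop : Continuous fun q : P => (x₀, q))).aestronglyMeasurable
  · exact (ae_restrict_iff' hK.measurableSet).2
      (Filter.Eventually.of_forall fun q hq x hx => hC (x, q) ⟨hx, hq⟩)
  · exact integrableOn_const hK.measure_lt_top.ne
  · exact Filter.Eventually.of_forall fun q x _ => (hd q x).differentiableAt.hasFDerivAt

universe v

/-- The derivative is an integral of the same kind with values in `E →L[ℝ] G`, so induction on the
order works if `G` varies. Placing `E` and `G` in one universe keeps that target space in the range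
of the induction. -/
theorem contDiff_setIntegral {E : Type v} {P : Type*} {G : Type v}
    [NormedAddCommGroup E] [NormedSpace ℝ E] [ProperSpace E]
    [NormedAddCommGroup P] [NormedSpace ℝ P] [MeasurableSpace P] [OpensMeasurableSpace P]
    [SecondCountableTopology P] [NormedAddCommGroup G] [NormedSpace ℝ G]
    {μ : Measure P} [IsFiniteMeasureOnCompacts μ] {K : Set P} (hK : IsCompact K)
    {Φ : E → P → G} (hΦ : ContDiff ℝ ∞ (Function.uncurry Φ)) :
    ContDiff ℝ ∞ (fun x => ∫ q in K, Φ x q ∂μ) := by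
  refine contDiff_infty.2 fun n => ?_
  induction n generalizing G with
  | zero =>
    refine contDiff_zero.2 (continuous_iff_continuousAt.2 fun x => ?_)
    exact (hasFDerivAt_setIntegral_of_contDiff hK hΦ x).continuousAt
  | succ n ih =>
    have := ih (contDiff_uncurry_fderiv_left hΦ)
    push_cast
    refine contDiff_succ_iff_fderiv.2 ⟨fun x =>
      (hasFDerivAt_setIntegral_of_contDiff hK hΦ x).differentiableAt, by simp, ?_⟩
    convert this using 1
    ext1 x
    exact (hasFDerivAt_setIntegral_of_contDiff hK hΦ x).fderiv

/-! ### Integrals of periodic functions over one cell -/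

/-- Period one in both variables. -/
def IsPeriodic {F : Type*} (g : Plane → F) : Prop :=
  ∀ (k : Fin 2) (l : ℤ) (x : Plane), g (x + (l : ℝ) • stdVec k) = g x

theorem IsPeriodic.comp_line {F : Type*} {g : Plane → F} (hg : IsPeriodic g) (k : Fin 2)
    (x : Plane) : Function.Periodic (fun t : ℝ => g (x + t • stdVec k)) 1 := by
  intro t
  have := hg k 1 (x + t • stdVec k)
  simp only [Int.cast_one, one_smul] at this
  simp only [add_smul, one_smul, ← add_assoc, this]

theorem IsPeriodic.fst {F : Type*} {g : Plane → F} (hg : IsPeriodic g) (t : ℝ) :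
    Function.Periodic (fun s : ℝ => g !₂[s, t]) 1 := by
  intro s
  simp only
  rw [← hg 0 1 !₂[s, t]]
  refine congrArg g ?_
  ext i; fin_cases i <;> simp

theorem IsPeriodic.snd {F : Type*} {g : Plane → F} (hg : IsPeriodic g) (s : ℝ) :
    Function.Periodic (fun t : ℝ => g !₂[s, t]) 1 := by
  intro t
  simp only
  rw [← hg 1 1 !₂[s, t]]
  refine congrArg g ?_
  ext i; fin_cases i <;> simp

theorem continuous_plane_mk : Continuous fun p : ℝ × ℝ => (!₂[p.1, p.2] : Plane) := by
  refine (PiLp.continuous_toLp 2 _).comp (continuous_pi fun i => ?_)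
  fin_cases i
  exacts [continuous_fst, continuous_snd]

section

variable {F : Type*} [NormedAddCommGroup F] [NormedSpace ℝ F]

theorem continuous_integral_snd {g : Plane → F} (hc : Continuous g) :
    Continuous fun s : ℝ => ∫ t in (0 : ℝ)..1, g !₂[s, t] :=
  intervalIntegral.continuous_parametric_intervalIntegral_of_continuous'
    (f := fun s t : ℝ => g !₂[s, t]) (hc.comp continuous_plane_mk) 0 1

theorem integral_unitCell_add {g : Plane → F} (hc : Continuous g) (hg : IsPeriodic g)
    (v : Plane) : ∫ x in unitCell, g (x + v) = ∫ x in unitCell, g x := by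
  have hv : ∀ s t : ℝ, (!₂[s, t] : Plane) + v = !₂[s + v 0, t + v 1] := fun s t => by
    ext i; fin_cases i <;> simp
  have hshift : ∀ (φ : ℝ → F), Function.Periodic φ 1 → ∀ a : ℝ,
      ∫ t in (0 : ℝ)..1, φ (t + a) = ∫ t in (0 : ℝ)..1, φ t := fun φ hφ a => by
    rw [intervalIntegral.integral_comp_add_right, zero_add, add_comm 1 a,
      hφ.intervalIntegral_add_eq a 0, zero_add]
  rw [integral_unitCell _ hc, integral_unitCell _ (by fun_prop)]
  simp only [hv]
  simp only [fun s => hshift _ (hg.snd s) (v 1)]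
  exact hshift (fun s => ∫ t in (0 : ℝ)..1, g !₂[s, t])
    (fun s => by simp only [fun t => hg.fst t s]) (v 0)

theorem integral_unitCell_dilate {g : Plane → F} (hc : Continuous g) (hg : IsPeriodic g)
    (n : ℕ+) : ∫ x in unitCell, g ((n : ℝ) • x) = ∫ x in unitCell, g x := by
  have hsm : ∀ s t : ℝ, (n : ℝ) • (!₂[s, t] : Plane) = !₂[(n : ℝ) * s, (n : ℝ) * t] :=
    fun s t => by ext i; fin_cases i <;> simp
  rw [integral_unitCell _ hc, integral_unitCell _ (by fun_prop)]
  simp only [hsm]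
  have h1 : ∀ s : ℝ, ∫ t in (0 : ℝ)..1, g !₂[(n : ℝ) * s, (n : ℝ) * t] =
      ∫ t in (0 : ℝ)..1, g !₂[(n : ℝ) * s, t] := fun s =>
    integral_dilate_periodic (fun t => g !₂[(n : ℝ) * s, t])
      (hc.comp (continuous_plane_mk.comp (by fun_prop : Continuous fun t : ℝ => ((n : ℝ) * s, t))))
      (hg.snd _) n
  simp only [h1]
  exact integral_dilate_periodic (fun s => ∫ t in (0 : ℝ)..1, g !₂[s, t])
    (continuous_integral_snd hc) (fun s => by simp only [fun t => hg.fst t s]) n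

end

/-! ### The `L¹` norm on the torus -/

theorem normL1Torus_nonneg {F : Type*} [NormedAddCommGroup F] (u : Plane → F) : 0 ≤ normL1Torus u :=
  integral_nonneg fun _ => norm_nonneg _

section

variable {F G : Type*} [NormedAddCommGroup F] [NormedSpace ℝ F]
  [NormedAddCommGroup G] [NormedSpace ℝ G]

theorem isPeriodic_torus (u : SmoothTorus F) : IsPeriodic u.1 := u.2.2.1

theorem continuous_torus (u : SmoothTorus F) : Continuous u.1 := u.2.1.continuous

theorem integrableOn_norm_torus (u : SmoothTorus F) :
    IntegrableOn (fun x => ‖u.1 x‖) unitCell :=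
  (integrableOn_unitCell u.2.1).norm

theorem normL1Torus_add_le (u v : SmoothTorus F) :
    normL1Torus (u + v).1 ≤ normL1Torus u.1 + normL1Torus v.1 := by
  unfold normL1Torus
  rw [← integral_add (integrableOn_norm_torus u) (integrableOn_norm_torus v)]
  exact integral_mono (integrableOn_norm_torus (u + v)) ((integrableOn_norm_torus u).add (integrableOn_norm_torus v))
    fun x => norm_add_le _ _

theorem normL1Torus_mapTorus_le [CompleteSpace F] [CompleteSpace G] (L : F →L[ℝ] G)
    (u : SmoothTorus F) : normL1Torus (mapTorus L u).1 ≤ ‖L‖ * normL1Torus u.1 := by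
  unfold normL1Torus
  rw [← integral_const_mul]
  exact integral_mono (integrableOn_norm_torus (mapTorus L u)) ((integrableOn_norm_torus u).const_mul _)
    fun x => L.le_opNorm _

theorem normL1Torus_dilate (u : SmoothTorus F) (n : ℕ+) :
    normL1Torus (fun x => u.1 ((n : ℝ) • x)) = normL1Torus u.1 :=
  integral_unitCell_dilate (g := fun x => ‖u.1 x‖) (continuous_torus u).norm
    (fun k l x => by simp only [isPeriodic_torus u k l x]) n

/-- `mapTorus L` as a linear map. -/
noncomputable def mapTorusLin [CompleteSpace F] [CompleteSpace G] (L : F →L[ℝ] G) :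
    SmoothTorus F →ₗ[ℝ] SmoothTorus G where
  toFun := mapTorus L
  map_add' _ _ := Subtype.ext (funext fun _ => L.map_add _ _)
  map_smul' c _ := Subtype.ext (funext fun _ => L.map_smul c _)

end

/-! ### Averages along coordinate lines -/

/-- The weighted average `∫₀¹ c(r) h(x + r e_k) dr`. -/
noncomputable def lineAvg (c : ℝ → ℝ) (k : Fin 2) (h : Plane → ℝ) (x : Plane) : ℝ :=
  ∫ r in Icc (0 : ℝ) 1, c r * h (x + r • stdVec k)

theorem setIntegral_Icc_eq_interval (φ : ℝ → ℝ) :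
    ∫ r in Icc (0 : ℝ) 1, φ r = ∫ r in (0 : ℝ)..1, φ r := by
  rw [intervalIntegral.integral_of_le zero_le_one, integral_Icc_eq_integral_Ioc]

theorem contDiff_lineAvg_integrand {c : ℝ → ℝ} (hc : ContDiff ℝ ∞ c) (k : Fin 2) {h : Plane → ℝ}
    (hh : ContDiff ℝ ∞ h) :
    ContDiff ℝ ∞ (Function.uncurry fun (x : Plane) (r : ℝ) => c r * h (x + r • stdVec k)) := by
  unfold Function.uncurry
  exact (hc.comp contDiff_snd).mul
    (hh.comp (contDiff_fst.add (contDiff_snd.smul contDiff_const)))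

theorem contDiff_lineAvg {c : ℝ → ℝ} (hc : ContDiff ℝ ∞ c) (k : Fin 2) {h : Plane → ℝ}
    (hh : ContDiff ℝ ∞ h) : ContDiff ℝ ∞ (lineAvg c k h) :=
  contDiff_setIntegral isCompact_Icc (contDiff_lineAvg_integrand hc k hh)

theorem IsPeriodic.lineAvg {c : ℝ → ℝ} {k : Fin 2} {h : Plane → ℝ} (hh : IsPeriodic h) :
    IsPeriodic (lineAvg c k h) := by
  intro j l x
  unfold _root_.lineAvg
  simp only [add_right_comm x, hh j l]

theorem integral_cell_swap {f : Plane → ℝ → ℝ} (hf : Continuous (Function.uncurry f)) :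
    ∫ x in unitCell, ∫ r in Icc (0 : ℝ) 1, f x r = ∫ r in Icc (0 : ℝ) 1, ∫ x in unitCell, f x r := by
  refine integral_integral_swap ?_
  rw [Measure.prod_restrict]
  exact hf.continuousOn.integrableOn_compact (isCompact_unitCell.prod isCompact_Icc)

/-- Weighted averages along the `k`-th direction, as a linear operator on the torus. -/
noncomputable def torusAvg (c : ℝ → ℝ) (hc : ContDiff ℝ ∞ c) (k : Fin 2) :
    SmoothTorus ℝ →ₗ[ℝ] SmoothTorus ℝ where
  toFun h := ⟨lineAvg c k h.1, contDiff_lineAvg hc k h.2.1, (isPeriodic_torus h).lineAvg, by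
    unfold lineAvg
    rw [integral_cell_swap (contDiff_lineAvg_integrand hc k h.2.1).continuous]
    simp only [integral_const_mul, integral_unitCell_add (continuous_torus h) (isPeriodic_torus h), h.2.2.2,
      mul_zero, integral_zero]⟩
  map_add' h h' := by
    refine Subtype.ext (funext fun x => ?_)
    have hi : ∀ g : SmoothTorus ℝ,
        IntegrableOn (fun r => c r * g.1 (x + r • stdVec k)) (Icc (0 : ℝ) 1) := fun g =>
      ((contDiff_lineAvg_integrand hc k g.2.1).continuous.comp
        (Continuous.prodMk_right x)).continuousOn.integrableOn_compact isCompact_Icc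
    change lineAvg c k (h.1 + h'.1) x = lineAvg c k h.1 x + lineAvg c k h'.1 x
    unfold lineAvg
    rw [← integral_add (hi h) (hi h')]
    simp only [Pi.add_apply, mul_add]
  map_smul' a h := by
    refine Subtype.ext (funext fun x => ?_)
    change lineAvg c k (a • h.1) x = a * lineAvg c k h.1 x
    unfold lineAvg
    rw [← integral_const_mul]
    simp only [Pi.smul_apply, smul_eq_mul, mul_left_comm]

/-- By Fubini the average is taken over `r` last, and every translate of `|h|` has the same integral
over a cell. -/
theorem normL1Torus_torusAvg_le {c : ℝ → ℝ} (hc : ContDiff ℝ ∞ c)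
    (hb : ∀ r ∈ Icc (0 : ℝ) 1, |c r| ≤ 1) (k : Fin 2) (h : SmoothTorus ℝ) :
    normL1Torus (torusAvg c hc k h).1 ≤ normL1Torus h.1 := by
  have hcont : Continuous (Function.uncurry fun (x : Plane) (r : ℝ) => ‖h.1 (x + r • stdVec k)‖) := by
    have := continuous_torus h
    unfold Function.uncurry
    fun_prop
  have hpt : ∀ x, ‖lineAvg c k h.1 x‖ ≤ ∫ r in Icc (0 : ℝ) 1, ‖h.1 (x + r • stdVec k)‖ := by
    intro x
    refine norm_integral_le_of_norm_le ?_ ?_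
    · exact (hcont.comp (Continuous.prodMk_right x)).continuousOn.integrableOn_compact isCompact_Icc
    · refine (ae_restrict_iff' measurableSet_Icc).2 (Filter.Eventually.of_forall fun r hr => ?_)
      rw [norm_mul]
      exact mul_le_of_le_one_left (norm_nonneg _) (hb r hr)
  calc normL1Torus (torusAvg c hc k h).1
      ≤ ∫ x in unitCell, ∫ r in Icc (0 : ℝ) 1, ‖h.1 (x + r • stdVec k)‖ := by
        refine integral_mono (integrableOn_norm_torus (torusAvg c hc k h)) ?_ hpt
        exact (continuous_parametric_integral_of_continuous hcont
          isCompact_Icc).continuousOn.integrableOn_compact isCompact_unitCell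
    _ = normL1Torus h.1 := by
        rw [integral_cell_swap hcont]
        have : ∀ r : ℝ, ∫ x in unitCell, ‖h.1 (x + r • stdVec k)‖ = normL1Torus h.1 := fun r =>
          integral_unitCell_add (g := fun x => ‖h.1 x‖) (continuous_torus h).norm
            (fun k l x => by simp only [isPeriodic_torus h k l x]) _
        simp only [this, integral_const, measureReal_restrict_apply_univ, Real.volume_real_Icc]
        simp

/-- The mean along the `k`-th direction. -/
noncomputable def dirMean (k : Fin 2) : SmoothTorus ℝ →ₗ[ℝ] SmoothTorus ℝ :=
  torusAvg (fun _ => 1) contDiff_const k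

/-- The periodic primitive along the `k`-th direction. -/
noncomputable def dirPrim (k : Fin 2) : SmoothTorus ℝ →ₗ[ℝ] SmoothTorus ℝ :=
  torusAvg (fun r => r - 1 / 2) (contDiff_id.sub contDiff_const) k

theorem dirMean_apply (k : Fin 2) (h : SmoothTorus ℝ) (x : Plane) :
    (dirMean k h).1 x = ∫ r in (0 : ℝ)..1, h.1 (x + r • stdVec k) := by
  change lineAvg _ k h.1 x = _
  simp only [lineAvg, one_mul, setIntegral_Icc_eq_interval]

theorem dirPrim_apply (k : Fin 2) (h : SmoothTorus ℝ) (x : Plane) :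
    (dirPrim k h).1 x = ∫ r in (0 : ℝ)..1, (r - 1 / 2) * h.1 (x + r • stdVec k) := by
  change lineAvg _ k h.1 x = _
  simp only [lineAvg, setIntegral_Icc_eq_interval]

theorem normL1Torus_dirMean_le (k : Fin 2) (h : SmoothTorus ℝ) :
    normL1Torus (dirMean k h).1 ≤ normL1Torus h.1 :=
  normL1Torus_torusAvg_le _ (fun _ _ => by simp) k h

theorem normL1Torus_dirPrim_le (k : Fin 2) (h : SmoothTorus ℝ) :
    normL1Torus (dirPrim k h).1 ≤ normL1Torus h.1 :=
  normL1Torus_torusAvg_le _ (fun r hr => by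
    rw [abs_le]; constructor <;> linarith [hr.1, hr.2]) k h

/-- Integration by parts in `r`: the weight `r - 1/2` equals `-1/2` and `1/2` at the ends, where `h`
takes the same value by periodicity, so the boundary term is `h x`; the slope `1` of the weight
produces the mean. -/
theorem fderiv_dirPrim (k : Fin 2) (h : SmoothTorus ℝ) (x : Plane) :
    fderiv ℝ (dirPrim k h).1 x (stdVec k) = h.1 x - (dirMean k h).1 x := by
  have hsm := contDiff_lineAvg_integrand (c := fun r => r - 1 / 2)
    (contDiff_id.sub contDiff_const) k h.2.1
  have h1 := (hasFDerivAt_setIntegral_of_contDiff (μ := volume)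
    (isCompact_Icc (a := (0 : ℝ)) (b := 1)) hsm x).fderiv
  have hline : ∀ r : ℝ, HasDerivAt (fun r : ℝ => h.1 (x + r • stdVec k))
      (fderiv ℝ h.1 (x + r • stdVec k) (stdVec k)) r := by
    intro r
    have h2 : HasDerivAt (fun r : ℝ => x + r • stdVec k) (stdVec k) r := by
      simpa using ((hasDerivAt_id r).smul_const (stdVec k)).const_add x
    exact (h.2.1.differentiable (by simp) _).hasFDerivAt.comp_hasDerivAt r h2
  have h3 : ∀ r : ℝ, fderiv ℝ (fun x : Plane => (r - 1 / 2) * h.1 (x + r • stdVec k)) x (stdVec k)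
      = (r - 1 / 2) * fderiv ℝ h.1 (x + r • stdVec k) (stdVec k) := by
    intro r
    have h4 : HasFDerivAt (fun x : Plane => h.1 (x + r • stdVec k))
        (fderiv ℝ h.1 (x + r • stdVec k)) x := by
      have := (h.2.1.differentiable (by simp) (x + r • stdVec k)).hasFDerivAt
      exact this.comp x ((hasFDerivAt_id x).add_const _)
    rw [(h4.const_mul (r - 1 / 2)).fderiv]
    rfl
  have hcd : Continuous fun r : ℝ => fderiv ℝ h.1 (x + r • stdVec k) (stdVec k) := by
    have := h.2.1.continuous_fderiv (by simp)
    fun_prop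
  change fderiv ℝ (fun x => ∫ r in Icc (0 : ℝ) 1, (r - 1 / 2) * h.1 (x + r • stdVec k)) x _ = _
  rw [h1, ContinuousLinearMap.integral_apply]
  · simp only [h3, setIntegral_Icc_eq_interval]
    rw [intervalIntegral.integral_mul_deriv_eq_deriv_mul
      (u := fun r : ℝ => r - 1 / 2) (u' := fun _ => 1)
      (fun r _ => (hasDerivAt_id r).sub_const _) (fun r _ => hline r)
      intervalIntegrable_const (hcd.intervalIntegrable 0 1), dirMean_apply]
    have hper := (isPeriodic_torus h).comp_line k x 0
    simp only [zero_add, zero_smul, add_zero] at hper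
    simp only [one_mul, hper, zero_smul, add_zero]
    ring
  · exact ((contDiff_uncurry_fderiv_left hsm).continuous.comp
      (Continuous.prodMk_right x)).continuousOn.integrableOn_compact isCompact_Icc

theorem dirMean_dilate (k : Fin 2) (n : ℕ+) (h : SmoothTorus ℝ) (x : Plane) :
    (dirMean k (oscillate n h)).1 x = (dirMean k h).1 ((n : ℝ) • x) := by
  have hc := continuous_torus h
  rw [dirMean_apply, dirMean_apply, ← integral_dilate_periodic
    (fun r : ℝ => h.1 ((n : ℝ) • x + r • stdVec k)) (by fun_prop) ((isPeriodic_torus h).comp_line k _) n]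
  simp only [oscillate, smul_add, smul_smul]

/-- Source of the gain `1/λ`. After rescaling to `[0, n]`, the weight on the `m`-th unit interval is
`n⁻¹ (r - 1/2)` plus the constant `n⁻¹ (m + 1/2) - 1/2`. These constants sum to zero over `m < n`,
so `φ` needs no mean-zero condition. -/
theorem integral_saw_dilate_periodic {φ : ℝ → ℝ} (hc : Continuous φ) (hφ : Function.Periodic φ 1)
    (n : ℕ+) :
    ∫ r in (0 : ℝ)..1, (r - 1 / 2) * φ ((n : ℝ) * r) =
      (n : ℝ)⁻¹ * ∫ r in (0 : ℝ)..1, (r - 1 / 2) * φ r := by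
  have hn : (n : ℝ) ≠ 0 := by exact_mod_cast n.ne_zero
  have hint : ∀ a b : ℝ, IntervalIntegrable (fun r => ((n : ℝ)⁻¹ * r - 1 / 2) * φ r) volume a b :=
    fun a b => (by fun_prop : Continuous fun r => ((n : ℝ)⁻¹ * r - 1 / 2) * φ r).intervalIntegrable _ _
  have h1 : ∫ r in (0 : ℝ)..1, (r - 1 / 2) * φ ((n : ℝ) * r) =
      (n : ℝ)⁻¹ * ∫ r in (0 : ℝ)..(n : ℕ), ((n : ℝ)⁻¹ * r - 1 / 2) * φ r := by
    have := intervalIntegral.integral_comp_mul_left (a := 0) (b := 1)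
      (fun r => ((n : ℝ)⁻¹ * r - 1 / 2) * φ r) hn
    simp only [inv_mul_cancel_left₀ hn, mul_zero, mul_one, smul_eq_mul] at this
    exact this
  have h2 : ∀ m : ℕ, ∫ r in (m : ℝ)..((m + 1 : ℕ) : ℝ), ((n : ℝ)⁻¹ * r - 1 / 2) * φ r =
      (n : ℝ)⁻¹ * (∫ r in (0 : ℝ)..1, (r - 1 / 2) * φ r) +
        ((n : ℝ)⁻¹ * (m + 1 / 2) - 1 / 2) * ∫ r in (0 : ℝ)..1, φ r := by
    intro m
    have h3 := intervalIntegral.integral_comp_add_right (a := 0) (b := 1)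
      (fun r => ((n : ℝ)⁻¹ * r - 1 / 2) * φ r) (m : ℝ)
    rw [zero_add, add_comm (1 : ℝ)] at h3
    push_cast
    rw [← h3, ← intervalIntegral.integral_const_mul, ← intervalIntegral.integral_const_mul,
      ← intervalIntegral.integral_add]
    · refine intervalIntegral.integral_congr fun r _ => ?_
      have := hφ.nat_mul m r
      simp only [mul_one] at this
      simp only [this]
      ring_nf
    · exact (by fun_prop : Continuous fun r => (n : ℝ)⁻¹ * ((r - 1 / 2) * φ r)).intervalIntegrable _ _
    · exact (hc.const_mul _).intervalIntegrable _ _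
  -- The upper limit `N` is kept independent of `n` for the induction; the right side vanishes at `N
  -- = n`.
  have hsum : ∀ N : ℕ, ∑ m ∈ Finset.range N, ((n : ℝ)⁻¹ * ((m : ℝ) + 1 / 2) - 1 / 2) =
      (n : ℝ)⁻¹ * ((N : ℝ) ^ 2 / 2) - N / 2 := by
    intro N
    induction N with
    | zero => simp
    | succ N ih => rw [Finset.sum_range_succ, ih]; push_cast; ring
  have h4 := intervalIntegral.sum_integral_adjacent_intervals
    (f := fun r => ((n : ℝ)⁻¹ * r - 1 / 2) * φ r) (a := fun m : ℕ => (m : ℝ)) (n := (n : ℕ))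
    (fun m _ => hint _ _)
  simp only [h2, Finset.sum_add_distrib, ← Finset.sum_mul, hsum, Finset.sum_const,
    Finset.card_range, nsmul_eq_mul, Nat.cast_zero] at h4
  rw [h1, ← h4]
  field_simp
  ring_nf

theorem dirPrim_dilate (k : Fin 2) (n : ℕ+) (h : SmoothTorus ℝ) (x : Plane) :
    (dirPrim k (oscillate n h)).1 x = (n : ℝ)⁻¹ * (dirPrim k h).1 ((n : ℝ) • x) := by
  have hc := continuous_torus h
  rw [dirPrim_apply, dirPrim_apply, ← integral_saw_dilate_periodic
    (φ := fun r : ℝ => h.1 ((n : ℝ) • x + r • stdVec k)) (by fun_prop) ((isPeriodic_torus h).comp_line k _) n]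
  simp only [oscillate, smul_add, smul_smul]

/-! ### The antidivergence on the torus -/

theorem fderiv_apply_eq_zero_of_line_const {f : Plane → ℝ} {x v : Plane}
    (hf : DifferentiableAt ℝ f x) (h : ∀ t : ℝ, f (x + t • v) = f x) : fderiv ℝ f x v = 0 := by
  rw [← hf.lineDeriv_eq_fderiv]
  unfold lineDeriv
  simp only [h, deriv_const]

theorem dirMean_add_smul (k : Fin 2) (h : SmoothTorus ℝ) (x : Plane) (t : ℝ) :
    (dirMean k h).1 (x + t • stdVec k) = (dirMean k h).1 x := by
  have hper := (isPeriodic_torus h).comp_line k x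
  rw [dirMean_apply, dirMean_apply]
  have := intervalIntegral.integral_comp_add_right (a := 0) (b := 1)
    (fun r : ℝ => h.1 (x + r • stdVec k)) t
  rw [zero_add, add_comm (1 : ℝ), hper.intervalIntegral_add_eq t 0, zero_add] at this
  rw [← this]
  simp only [add_smul, ← add_assoc, add_right_comm x]

/-- A mean along `e_k` is constant in that direction, and averaging translates preserves this. It
removes from each row of the divergence the off-diagonal term that corrects the other row. -/
theorem fderiv_dirPrim_dirMean (j k : Fin 2) (h : SmoothTorus ℝ) (x : Plane) :
    fderiv ℝ (dirPrim j (dirMean k h)).1 x (stdVec k) = 0 := by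
  refine fderiv_apply_eq_zero_of_line_const
    ((dirPrim j (dirMean k h)).2.1.differentiable (by simp) x) fun t => ?_
  simp only [dirPrim_apply]
  refine intervalIntegral.integral_congr fun r _ => ?_
  simp only [add_right_comm x (t • stdVec k), dirMean_add_smul]

theorem dirMean_comm (j k : Fin 2) (h : SmoothTorus ℝ) :
    dirMean j (dirMean k h) = dirMean k (dirMean j h) := by
  refine Subtype.ext (funext fun x => ?_)
  have hc := continuous_torus h
  simp only [dirMean_apply]
  rw [intervalIntegral_intervalIntegral_swap]
  · simp only [add_right_comm x]
  · refine IntegrableOn.mono_set (t := Icc (0 : ℝ) 1 ×ˢ Icc (0 : ℝ) 1) ?_ ?_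
    · refine Continuous.continuousOn ?_ |>.integrableOn_compact (isCompact_Icc.prod isCompact_Icc)
      unfold Function.uncurry
      fun_prop
    · rw [uIoc_of_le zero_le_one]
      exact prod_mono Ioc_subset_Icc_self Ioc_subset_Icc_self

/-- The iterated line mean at `x` is the cell integral of a translate of `h`. This is where the
mean-zero condition makes the torus equation solvable. -/
theorem dirMean_zero_dirMean_one (h : SmoothTorus ℝ) : dirMean 0 (dirMean 1 h) = 0 := by
  refine Subtype.ext (funext fun x => ?_)
  have hc := continuous_torus h
  have hz : ∫ y in unitCell, h.1 (y + x) = 0 := by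
    rw [integral_unitCell_add hc (isPeriodic_torus h), h.2.2.2]
  rw [integral_unitCell _ (by fun_prop)] at hz
  simp only [dirMean_apply]
  refine Eq.trans ?_ hz
  refine intervalIntegral.integral_congr fun s _ => intervalIntegral.integral_congr fun t _ => ?_
  refine congrArg h.1 ?_
  ext i; fin_cases i <;> simp [add_comm]

/-- Continuous linear maps between normed spaces, with the norm topologies. -/
abbrev NormedHom (F G : Type*) [NormedAddCommGroup F] [NormedSpace ℝ F]
    [NormedAddCommGroup G] [NormedSpace ℝ G] : Type _ := F →L[ℝ] G

/-- The symmetric matrix with entry `a` at the `k`-th place of the diagonal. -/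
noncomputable def diagSym (k : Fin 2) : NormedHom ℝ SymMat :=
  LinearMap.toContinuousLinearMap
    { toFun := fun a => ⟨Matrix.diagonal (Pi.single k a), Matrix.isSymm_diagonal _⟩
      map_add' := fun a b => Subtype.ext (by simp [Pi.single_add, Matrix.diagonal_add])
      map_smul' := fun c a => Subtype.ext (by simp [← Matrix.diagonal_smul, ← Pi.single_smul]) }

/-- The symmetric matrix with both off-diagonal entries equal to `a`. -/
noncomputable def offDiagSym : NormedHom ℝ SymMat :=
  LinearMap.toContinuousLinearMap
    { toFun := fun a => ⟨!![0, a; a, 0], Matrix.IsSymm.ext fun i j => by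
        fin_cases i <;> fin_cases j <;> rfl⟩
      map_add' := fun a b => Subtype.ext (by simp)
      map_smul' := fun c a => Subtype.ext (by simp) }

theorem diagSym_apply (k : Fin 2) (a : ℝ) :
    (diagSym k a).1 = Matrix.diagonal (Pi.single k a) := rfl

theorem offDiagSym_apply (a : ℝ) : (offDiagSym a).1 = !![0, a; a, 0] := rfl

/-- The `i`-th component of a vector field on the torus. -/
noncomputable def compTorus (i : Fin 2) : SmoothTorus Plane →ₗ[ℝ] SmoothTorus ℝ :=
  mapTorusLin (EuclideanSpace.proj i)

/-- An antidivergence on the torus that integrates along the coordinate directions. -/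
noncomputable def torusAntidiv : TorusOperator :=
  mapTorusLin (diagSym 0) ∘ₗ dirPrim 0 ∘ₗ compTorus 0 +
  mapTorusLin (diagSym 1) ∘ₗ dirPrim 1 ∘ₗ compTorus 1 +
  mapTorusLin offDiagSym ∘ₗ
    (dirPrim 1 ∘ₗ dirMean 0 ∘ₗ compTorus 0 + dirPrim 0 ∘ₗ dirMean 1 ∘ₗ compTorus 1)

theorem torusAntidiv_apply (u : SmoothTorus Plane) (x : Plane) :
    (torusAntidiv u).1 x = diagSym 0 ((dirPrim 0 (compTorus 0 u)).1 x) +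
      diagSym 1 ((dirPrim 1 (compTorus 1 u)).1 x) +
      offDiagSym ((dirPrim 1 (dirMean 0 (compTorus 0 u))).1 x +
        (dirPrim 0 (dirMean 1 (compTorus 1 u))).1 x) := rfl

/-- In each row the diagonal entry recovers `u_i` up to its mean along `e_i`. The off-diagonal entry
integrates that mean in the other direction, with an error equal to the full mean, hence zero. -/
theorem isTorusAntidivergence_torusAntidiv : IsTorusAntidivergence torusAntidiv := by
  intro u
  have hd : ∀ (h : SmoothTorus ℝ) (x : Plane), DifferentiableAt ℝ h.1 x := fun h x =>
    h.2.1.differentiable (by simp) x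
  have h00 : (fun y => ((torusAntidiv u).1 y).1 0 0) = (dirPrim 0 (compTorus 0 u)).1 := by
    ext y; simp [torusAntidiv_apply, diagSym_apply, offDiagSym_apply]
  have h11 : (fun y => ((torusAntidiv u).1 y).1 1 1) = (dirPrim 1 (compTorus 1 u)).1 := by
    ext y; simp [torusAntidiv_apply, diagSym_apply, offDiagSym_apply]
  have h01 : (fun y => ((torusAntidiv u).1 y).1 0 1) =
      (dirPrim 1 (dirMean 0 (compTorus 0 u))).1 + (dirPrim 0 (dirMean 1 (compTorus 1 u))).1 := by
    ext y; simp [torusAntidiv_apply, diagSym_apply, offDiagSym_apply]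
  have h10 : (fun y => ((torusAntidiv u).1 y).1 1 0) =
      (dirPrim 1 (dirMean 0 (compTorus 0 u))).1 + (dirPrim 0 (dirMean 1 (compTorus 1 u))).1 := by
    ext y; simp [torusAntidiv_apply, diagSym_apply, offDiagSym_apply]
  funext x
  ext i
  fin_cases i
  · change ∑ j, fderiv ℝ (fun y => ((torusAntidiv u).1 y).1 0 j) x (stdVec j) = u.1 x 0
    rw [Fin.sum_univ_two, h00, h01, fderiv_add (hd _ x) (hd _ x), add_apply,
      fderiv_dirPrim, fderiv_dirPrim, fderiv_dirPrim_dirMean, dirMean_comm 1 0,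
      dirMean_zero_dirMean_one]
    simp [compTorus, mapTorusLin, mapTorus]
  · change ∑ j, fderiv ℝ (fun y => ((torusAntidiv u).1 y).1 1 j) x (stdVec j) = u.1 x 1
    rw [Fin.sum_univ_two, h10, h11, fderiv_add (hd _ x) (hd _ x), add_apply,
      fderiv_dirPrim, fderiv_dirPrim, fderiv_dirPrim_dirMean,
      dirMean_zero_dirMean_one]
    simp [compTorus, mapTorusLin, mapTorus]

/-- Means commute with dilation and each summand contains exactly one primitive, so the factor `n⁻¹`
is exact. -/
theorem torusAntidiv_oscillate (n : ℕ+) (u : SmoothTorus Plane) (x : Plane) :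
    (torusAntidiv (oscillate n u)).1 x = (n : ℝ)⁻¹ • (torusAntidiv u).1 ((n : ℝ) • x) := by
  have hc : ∀ i, compTorus i (oscillate n u) = oscillate n (compTorus i u) := fun _ => rfl
  have hm : ∀ k h, dirMean k (oscillate n h) = oscillate n (dirMean k h) := fun k h =>
    Subtype.ext (funext fun y => dirMean_dilate k n h y)
  simp only [torusAntidiv_apply, hc, hm, dirPrim_dilate, ← smul_eq_mul, ← smul_add, map_smul]

theorem normL1Torus_torusAntidiv_le : ∃ K : ℝ, 0 ≤ K ∧ ∀ u : SmoothTorus Plane,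
    normL1Torus (torusAntidiv u).1 ≤ K * normL1Torus u.1 := by
  let p : Fin 2 → (Plane →L[ℝ] ℝ) := fun i => EuclideanSpace.proj i
  refine ⟨‖diagSym 0‖ * ‖p 0‖ + ‖diagSym 1‖ * ‖p 1‖ + ‖offDiagSym‖ * (‖p 0‖ + ‖p 1‖),
    by positivity, fun u => ?_⟩
  have hcomp : ∀ i, normL1Torus (compTorus i u).1 ≤ ‖p i‖ * normL1Torus u.1 := fun i =>
    normL1Torus_mapTorus_le (p i) u
  have hmean : ∀ j k i, normL1Torus (dirPrim j (dirMean k (compTorus i u))).1 ≤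
      ‖p i‖ * normL1Torus u.1 := fun j k i =>
    (normL1Torus_dirPrim_le j _).trans ((normL1Torus_dirMean_le k _).trans (hcomp i))
  have hprim : ∀ j i, normL1Torus (dirPrim j (compTorus i u)).1 ≤ ‖p i‖ * normL1Torus u.1 :=
    fun j i => (normL1Torus_dirPrim_le j _).trans (hcomp i)
  have hmap : ∀ (L : NormedHom ℝ SymMat) (h : SmoothTorus ℝ) (b : ℝ), normL1Torus h.1 ≤ b →
      normL1Torus (mapTorusLin L h).1 ≤ ‖L‖ * b := fun L h b hb =>
    (normL1Torus_mapTorus_le L h).trans (mul_le_mul_of_nonneg_left hb (norm_nonneg _))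
  refine (normL1Torus_add_le _ _).trans ((add_le_add ((normL1Torus_add_le _ _).trans
    (add_le_add (hmap _ _ _ (hprim 0 0)) (hmap _ _ _ (hprim 1 1))))
    (hmap _ _ _ ((normL1Torus_add_le _ _).trans
      (add_le_add (hmean 1 0 0) (hmean 0 1 1))))).trans (le_of_eq ?_))
  ring

theorem exists_torusAntidivergence_oscillationBound :
    ∃ D : TorusOperator, IsTorusAntidivergence D ∧ ∃ K : ℝ, HasOscillationBound D K := by
  obtain ⟨K, hK, hb⟩ := normL1Torus_torusAntidiv_le
  refine ⟨torusAntidiv, isTorusAntidivergence_torusAntidiv, K, hK, fun n u => ?_⟩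
  have h1 : normL1Torus (torusAntidiv (oscillate n u)).1 =
      (n : ℝ)⁻¹ * normL1Torus (torusAntidiv u).1 := by
    rw [← normL1Torus_dilate (torusAntidiv u) n]
    unfold normL1Torus
    rw [← integral_const_mul]
    simp only [torusAntidiv_oscillate, norm_smul, norm_inv, Real.norm_natCast]
  rw [h1, div_eq_inv_mul, mul_assoc]
  exact mul_le_mul_of_nonneg_left (hb u) (by positivity)

/-! ### Smooth functions with compact support in the unit ball -/

theorem ae_norm_le_eLpNorm_top {F : Type*} [NormedAddCommGroup F] {f : Plane → F} (hc : Continuous f) (hs : HasCompactSupport f) :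
    ∀ᵐ x, ‖f x‖ ≤ (eLpNorm f ⊤ volume).toReal := by
  have hm : eLpNorm f ⊤ volume ≠ ⊤ := (hc.memLp_top_of_hasCompactSupport hs volume).2.ne
  rw [eLpNorm_exponent_top] at hm ⊢
  filter_upwards [ae_le_eLpNormEssSup (f := f) (μ := volume)] with x hx
  rw [← toReal_enorm]
  exact ENNReal.toReal_mono hm hx

section

variable {F G : Type*} [NormedAddCommGroup F] [NormedSpace ℝ F]
  [NormedAddCommGroup G] [NormedSpace ℝ G]

theorem continuous_ball (f : SmoothBall F) : Continuous f.1 := f.2.1.continuous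

theorem integrable_ball (f : SmoothBall F) : Integrable f.1 :=
  (continuous_ball f).integrable_of_hasCompactSupport f.2.2.1

theorem mem_smoothBall_of_radius {f : Plane → F} (hf : ContDiff ℝ ∞ f) {r : ℝ} (hr : r < 1)
    (h : ∀ x, r < ‖x‖ → f x = 0) : f ∈ SmoothBall F := by
  have hs : tsupport f ⊆ Metric.closedBall 0 r := by
    refine closure_minimal (fun x hx => ?_) Metric.isClosed_closedBall
    by_contra hx'
    exact hx (h x (by simpa using hx'))
  exact ⟨hf, HasCompactSupport.of_support_subset_isCompact (isCompact_closedBall 0 r)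
    (subset_closure.trans hs), hs.trans (Metric.closedBall_subset_ball hr)⟩

/-- Compactness of the support inside the open ball leaves a margin. Together with
`mem_smoothBall_of_radius` it reduces support questions to vanishing beyond a radius below one. -/
theorem exists_radius (f : SmoothBall F) :
    ∃ r < 1, 0 ≤ r ∧ (∀ x, r < ‖x‖ → f.1 x = 0) ∧ ∀ x, r < ‖x‖ → fderiv ℝ f.1 x = 0 := by
  have hc : IsCompact (tsupport f.1) := f.2.2.1
  obtain ⟨r, hr, hs⟩ : ∃ r < 1, tsupport f.1 ⊆ Metric.closedBall 0 r := by
    rcases (tsupport f.1).eq_empty_or_nonempty with h | h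
    · exact ⟨0, one_pos, by simp [h]⟩
    · obtain ⟨x, hx, hmax⟩ := hc.exists_isMaxOn h continuous_norm.continuousOn
      exact ⟨‖x‖, by simpa using f.2.2.2 hx, fun y hy => by simpa using hmax hy⟩
  have key : ∀ x, max r 0 < ‖x‖ → x ∉ tsupport f.1 := fun x hx hx' => by
    have := hs hx'
    simp only [mem_closedBall_zero_iff] at this
    exact absurd ((le_max_left r 0).trans_lt hx) (not_lt.2 this)
  refine ⟨max r 0, max_lt hr one_pos, le_max_right _ _,
    fun x hx => image_eq_zero_of_notMem_tsupport (key x hx), fun x hx => ?_⟩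
  exact image_eq_zero_of_notMem_tsupport fun h => key x hx (tsupport_fderiv_subset ℝ h)

/-- Pointwise application of a continuous linear map. -/
noncomputable def mapBall (L : F →L[ℝ] G) : SmoothBall F →ₗ[ℝ] SmoothBall G where
  toFun f := ⟨fun x => L (f.1 x), by
    obtain ⟨r, hr, -, h, -⟩ := exists_radius f
    exact mem_smoothBall_of_radius (L.contDiff.comp f.2.1) hr fun x hx => by
      rw [h x hx, map_zero]⟩
  map_add' _ _ := Subtype.ext (funext fun _ => L.map_add _ _)
  map_smul' c _ := Subtype.ext (funext fun _ => L.map_smul c _)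

/-- The partial derivatives of a compactly supported function. -/
noncomputable def partialBall (k : Fin 2) : SmoothBall ℝ →ₗ[ℝ] SmoothBall ℝ where
  toFun f := ⟨fun x => fderiv ℝ f.1 x (stdVec k), by
    obtain ⟨r, hr, -, -, h⟩ := exists_radius f
    exact mem_smoothBall_of_radius ((f.2.1.fderiv_right (m := ∞) (by simp)).clm_apply contDiff_const)
      hr fun x hx => by rw [h x hx]; rfl⟩
  map_add' f g := Subtype.ext (funext fun x => by
    change fderiv ℝ (f.1 + g.1) x (stdVec k) = fderiv ℝ f.1 x (stdVec k) + fderiv ℝ g.1 x (stdVec k)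
    rw [fderiv_add (f.2.1.differentiable (by simp) x) (g.2.1.differentiable (by simp) x)]
    rfl)
  map_smul' c f := Subtype.ext (funext fun x => by
    change fderiv ℝ (c • f.1) x (stdVec k) = c • fderiv ℝ f.1 x (stdVec k)
    rw [fderiv_const_smul (f.2.1.differentiable (by simp) x)]
    rfl)

/-- The product of a cut-off function and a function on the torus. -/
noncomputable def mulBall : SmoothBall ℝ →ₗ[ℝ] SmoothTorus F →ₗ[ℝ] SmoothBall F :=
  LinearMap.mk₂ ℝ
    (fun f u => ⟨fun x => f.1 x • u.1 x, by
      obtain ⟨r, hr, -, h, -⟩ := exists_radius f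
      exact mem_smoothBall_of_radius (f.2.1.smul u.2.1) hr fun x hx => by rw [h x hx, zero_smul]⟩)
    (fun f f' u => Subtype.ext (funext fun x => add_smul _ _ _))
    (fun c f u => Subtype.ext (funext fun x => smul_assoc c (f.1 x) (u.1 x)))
    (fun f u u' => Subtype.ext (funext fun x => smul_add _ _ _))
    (fun c f u => Subtype.ext (funext fun x => smul_comm _ _ _))

theorem mulBall_apply (f : SmoothBall ℝ) (u : SmoothTorus F) (x : Plane) :
    (mulBall f u).1 x = f.1 x • u.1 x := rfl

theorem normL1Plane_nonneg (f : SmoothBall F) : 0 ≤ normL1Plane f.1 :=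
  integral_nonneg fun _ => norm_nonneg _

theorem normL1Plane_add_le (f g : SmoothBall F) :
    normL1Plane (f + g).1 ≤ normL1Plane f.1 + normL1Plane g.1 := by
  unfold normL1Plane
  rw [← integral_add (integrable_ball f).norm (integrable_ball g).norm]
  exact integral_mono (integrable_ball (f + g)).norm
    ((integrable_ball f).norm.add (integrable_ball g).norm) fun x => norm_add_le _ _

theorem normL1Plane_sub_le (f g : SmoothBall F) :
    normL1Plane (f - g).1 ≤ normL1Plane f.1 + normL1Plane g.1 := by
  unfold normL1Plane
  rw [← integral_add (integrable_ball f).norm (integrable_ball g).norm]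
  exact integral_mono (integrable_ball (f - g)).norm
    ((integrable_ball f).norm.add (integrable_ball g).norm) fun x => norm_sub_le _ _

theorem norm_integral_ball_le (f : SmoothBall F) : ‖∫ x, f.1 x‖ ≤ normL1Plane f.1 :=
  norm_integral_le_integral_norm _

theorem normL1Plane_mapBall_le (L : F →L[ℝ] G) (f : SmoothBall F) :
    normL1Plane (mapBall L f).1 ≤ ‖L‖ * normL1Plane f.1 := by
  unfold normL1Plane
  rw [← integral_const_mul]
  exact integral_mono (integrable_ball (mapBall L f)).norm ((integrable_ball f).norm.const_mul _)
    fun x => L.le_opNorm _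

/-- The ball lies in `(-1, 1)²`, which four integer translates of the cell cover; hence the factor
`4` in the estimates that compare the ball with the torus. -/
theorem unitBall_subset_cells : Metric.ball (0 : Plane) 1 ⊆
    ⋃ p : Fin 2 × Fin 2, (fun x : Plane => x + !₂[(p.1 : ℝ), (p.2 : ℝ)]) ⁻¹' unitCell := by
  intro x hx
  have hb : ∀ i, |x i| < 1 := fun i =>
    (PiLp.norm_apply_le x i).trans_lt (by simpa using hx)
  have key : ∀ t : ℝ, |t| < 1 → ∃ a : Fin 2, t + (a : ℝ) ∈ Icc (0 : ℝ) 1 := by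
    intro t ht
    rw [abs_lt] at ht
    rcases le_total 0 t with h | h
    · exact ⟨0, by simp [h, ht.2.le]⟩
    · exact ⟨1, by constructor <;> simp <;> linarith⟩
  obtain ⟨a, ha⟩ := key _ (hb 0)
  obtain ⟨b, hb⟩ := key _ (hb 1)
  refine mem_iUnion.2 ⟨(a, b), fun i => ?_⟩
  fin_cases i
  · simpa using ha
  · simpa using hb

theorem setIntegral_unitBall_le (u : SmoothTorus F) :
    ∫ x in Metric.ball (0 : Plane) 1, ‖u.1 x‖ ≤ 4 * normL1Torus u.1 := by
  have hc := continuous_torus u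
  let v : Fin 2 × Fin 2 → Plane := fun p => !₂[(p.1 : ℝ), (p.2 : ℝ)]
  have hv : ∀ p x, u.1 (x + v p) = u.1 x := by
    intro p x
    have h1 := isPeriodic_torus u 0 (p.1 : ℕ) x
    have h2 := isPeriodic_torus u 1 (p.2 : ℕ) (x + (((p.1 : ℕ) : ℤ) : ℝ) • stdVec 0)
    rw [← h1, ← h2]
    refine congrArg u.1 ?_
    ext i; fin_cases i <;> simp [v]
  have hcell : ∀ p, ∫ x in (fun x : Plane => x + v p) ⁻¹' unitCell, ‖u.1 x‖ = normL1Torus u.1 := by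
    intro p
    have := (measurePreserving_add_right (volume : Measure Plane) (v p)).setIntegral_preimage_emb
      (measurableEmbedding_addRight (v p)) (fun x => ‖u.1 x‖) unitCell
    simp only [hv] at this
    exact this
  have hint : ∀ p, Integrable (fun x => ‖u.1 x‖)
      (volume.restrict ((fun x : Plane => x + v p) ⁻¹' unitCell)) := fun p =>
    hc.norm.continuousOn.integrableOn_compact
      ((Homeomorph.addRight (v p)).isCompact_preimage.2 isCompact_unitCell)
  have hle : (volume : Measure Plane).restrict (Metric.ball 0 1) ≤
      ∑ p, volume.restrict ((fun x : Plane => x + v p) ⁻¹' unitCell) := by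
    rw [← Measure.sum_fintype]
    exact (Measure.restrict_mono unitBall_subset_cells le_rfl).trans Measure.restrict_iUnion_le
  refine (integral_mono_measure hle (Filter.Eventually.of_forall fun x => norm_nonneg _)
    (integrable_finsetSum_measure.2 fun p _ => hint p)).trans ?_
  rw [integral_finsetSum_measure fun p _ => hint p]
  simp only [hcell]
  simp

theorem normL1Plane_mulBall_le (f : SmoothBall ℝ) (u : SmoothTorus F) {c : ℝ}
    (hf : ∀ᵐ x, ‖f.1 x‖ ≤ c) : normL1Plane (mulBall f u).1 ≤ 4 * c * normL1Torus u.1 := by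
  have hc0 : 0 ≤ c := by
    obtain ⟨x, hx⟩ := hf.exists
    exact (norm_nonneg _).trans hx
  have h1 : normL1Plane (mulBall f u).1 =
      ∫ x in Metric.ball (0 : Plane) 1, ‖(mulBall f u).1 x‖ := by
    refine (setIntegral_eq_integral_of_forall_compl_eq_zero fun x hx => ?_).symm
    rw [image_eq_zero_of_notMem_tsupport fun h => hx ((mulBall f u).2.2.2 h), norm_zero]
  have hint : IntegrableOn (fun x => ‖u.1 x‖) (Metric.ball (0 : Plane) 1) :=
    ((continuous_torus u).norm.continuousOn.integrableOn_compact
      (isCompact_closedBall (0 : Plane) 1)).mono_set Metric.ball_subset_closedBall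
  calc normL1Plane (mulBall f u).1
      ≤ ∫ x in Metric.ball (0 : Plane) 1, c * ‖u.1 x‖ := by
        rw [h1]
        refine integral_mono_ae (integrable_ball _).norm.integrableOn (hint.const_mul c) ?_
        filter_upwards [ae_restrict_of_ae hf] with x hx
        rw [mulBall_apply, norm_smul]
        exact mul_le_mul_of_nonneg_right hx (norm_nonneg _)
    _ ≤ 4 * c * normL1Torus u.1 := by
        rw [integral_const_mul, mul_comm 4 c, mul_assoc]
        exact mul_le_mul_of_nonneg_left (setIntegral_unitBall_le u) hc0

theorem ae_norm_le_normW1Inf (f : SmoothBall F) : ∀ᵐ x, ‖f.1 x‖ ≤ normW1Inf f.1 := by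
  filter_upwards [ae_norm_le_eLpNorm_top (continuous_ball f) f.2.2.1] with x hx
  exact hx.trans (le_add_of_nonneg_right ENNReal.toReal_nonneg)

theorem ae_norm_fderiv_le_normW1Inf (f : SmoothBall F) :
    ∀ᵐ x, ‖fderiv ℝ f.1 x‖ ≤ normW1Inf f.1 := by
  filter_upwards [ae_norm_le_eLpNorm_top (f.2.1.continuous_fderiv (by simp))
    (f.2.2.1.fderiv ℝ)] with x hx
  exact hx.trans (le_add_of_nonneg_left ENNReal.toReal_nonneg)

theorem ae_norm_partialBall_le (f : SmoothBall ℝ) (k : Fin 2) :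
    ∀ᵐ x, ‖(partialBall k f).1 x‖ ≤ normW1Inf f.1 := by
  filter_upwards [ae_norm_fderiv_le_normW1Inf f] with x hx
  refine ((fderiv ℝ f.1 x).le_opNorm _).trans ?_
  simpa using hx

theorem normW1Inf_nonneg (f : Plane → F) : 0 ≤ normW1Inf f :=
  add_nonneg ENNReal.toReal_nonneg ENNReal.toReal_nonneg

theorem normW1Inf_comp_le (f : SmoothBall F) (L : F →L[ℝ] G) (hL : ‖L‖ ≤ 1) :
    normW1Inf (mapBall L f).1 ≤ normW1Inf f.1 := by
  have hL' : ∀ y, ‖L y‖ ≤ ‖y‖ := fun y =>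
    (L.le_opNorm y).trans (mul_le_of_le_one_left (norm_nonneg _) hL)
  have hd : ∀ x, fderiv ℝ (mapBall L f).1 x = L.comp (fderiv ℝ f.1 x) := fun x =>
    (L.hasFDerivAt.comp x (f.2.1.differentiable (by simp) x).hasFDerivAt).fderiv
  refine add_le_add (ENNReal.toReal_mono ?_ (eLpNorm_mono fun x => hL' _))
    (ENNReal.toReal_mono ?_ (eLpNorm_mono fun x => ?_))
  · exact ((continuous_ball f).memLp_top_of_hasCompactSupport f.2.2.1 volume).2.ne
  · exact ((f.2.1.continuous_fderiv (by simp)).memLp_top_of_hasCompactSupport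
      (f.2.2.1.fderiv ℝ) volume).2.ne
  · rw [hd]
    exact (L.opNorm_comp_le _).trans (mul_le_of_le_one_left (norm_nonneg _) hL)

end

/-! ### Integration by parts -/

theorem integral_mul_partialBall {a : Plane → ℝ} (ha : ContDiff ℝ ∞ a) (f : SmoothBall ℝ)
    (k : Fin 2) :
    ∫ x, a x * (partialBall k f).1 x = -∫ x, fderiv ℝ a x (stdVec k) * f.1 x := by
  have hc := f.2.2.1
  have hcf := continuous_ball f
  have hca := ha.continuous
  have hcd : Continuous fun x => fderiv ℝ a x (stdVec k) :=
    (ha.continuous_fderiv (by simp)).clm_apply continuous_const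
  have hcp := continuous_ball (partialBall k f)
  exact integral_mul_fderiv_eq_neg_fderiv_mul_of_integrable
    ((hcd.mul hcf).integrable_of_hasCompactSupport hc.mul_left)
    ((hca.mul hcp).integrable_of_hasCompactSupport (partialBall k f).2.2.1.mul_left)
    ((hca.mul hcf).integrable_of_hasCompactSupport hc.mul_left)
    (fun x _ => ha.differentiable (by simp) x) (fun x _ => f.2.1.differentiable (by simp) x)

theorem integral_partialBall (f : SmoothBall ℝ) (k : Fin 2) : ∫ x, (partialBall k f).1 x = 0 := by
  simpa using integral_mul_partialBall (a := fun _ => 1) contDiff_const f k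

theorem contDiff_coord (i : Fin 2) : ContDiff ℝ ∞ fun x : Plane => x i :=
  (EuclideanSpace.proj (𝕜 := ℝ) i).contDiff

theorem integral_coord_mul_partialBall (f : SmoothBall ℝ) (i k : Fin 2) :
    ∫ x : Plane, x i * (partialBall k f).1 x = if i = k then -∫ x, f.1 x else 0 := by
  have h : ∀ x : Plane, fderiv ℝ (fun x : Plane => x i) x (stdVec k) = if i = k then 1 else 0 := by
    intro x
    have := (EuclideanSpace.proj (𝕜 := ℝ) i : Plane →L[ℝ] ℝ).hasFDerivAt (x := x)
    rw [HasFDerivAt.fderiv (f := fun x : Plane => x i) this]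
    simp
  rw [integral_mul_partialBall (contDiff_coord i) f k]
  simp only [h]
  split_ifs <;> simp

/-! ### Moments and the momentum projection -/

/-- The `j`-th component of a vector field in the ball. -/
noncomputable def compBall (j : Fin 2) : SmoothBall Plane →ₗ[ℝ] SmoothBall ℝ :=
  mapBall (EuclideanSpace.proj j : Plane →L[ℝ] ℝ)

theorem compBall_apply (j : Fin 2) (g : SmoothBall Plane) (x : Plane) :
    (compBall j g).1 x = g.1 x j := rfl

theorem integrable_coord_mul (i : Fin 2) (f : SmoothBall ℝ) :
    Integrable fun x : Plane => x i * f.1 x :=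
  (((contDiff_coord i).continuous.mul (continuous_ball f))).integrable_of_hasCompactSupport
    f.2.2.1.mul_left

/-- The first moments `∫ x_i g_j dx`. -/
noncomputable def firstMoment (i j : Fin 2) : SmoothBall Plane →ₗ[ℝ] ℝ where
  toFun g := ∫ x : Plane, x i * g.1 x j
  map_add' g h := by
    refine Eq.trans ?_ (integral_add (integrable_coord_mul i (compBall j g))
      (integrable_coord_mul i (compBall j h)))
    exact integral_congr_ae (Filter.Eventually.of_forall fun x => mul_add _ _ _)
  map_smul' c g := by
    rw [RingHom.id_apply, smul_eq_mul, ← integral_const_mul]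
    exact integral_congr_ae (Filter.Eventually.of_forall fun x => mul_left_comm _ _ _)

theorem firstMoment_apply (i j : Fin 2) (g : SmoothBall Plane) :
    firstMoment i j g = ∫ x : Plane, x i * g.1 x j := rfl

/-- The total momentum. -/
noncomputable def totalMomentum : SmoothBall Plane →ₗ[ℝ] Plane where
  toFun g := ∫ x, g.1 x
  map_add' g h := integral_add (integrable_ball g) (integrable_ball h)
  map_smul' c g := integral_smul c g.1

theorem angularMomentum_eq (g : SmoothBall Plane) :
    angularMomentum g.1 = firstMoment 0 1 g - firstMoment 1 0 g :=
  integral_sub (integrable_coord_mul 0 (compBall 1 g)) (integrable_coord_mul 1 (compBall 0 g))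

theorem totalMomentum_apply_coord (g : SmoothBall Plane) (j : Fin 2) :
    totalMomentum g j = ∫ x, g.1 x j :=
  ((EuclideanSpace.proj (𝕜 := ℝ) j : Plane →L[ℝ] ℝ).integral_comp_comm (integrable_ball g)).symm

theorem abs_firstMoment_le (i j : Fin 2) (g : SmoothBall Plane) :
    |firstMoment i j g| ≤ normL1Plane g.1 := by
  rw [firstMoment_apply, ← Real.norm_eq_abs]
  refine norm_integral_le_of_norm_le (integrable_ball g).norm
    (Filter.Eventually.of_forall fun x => ?_)
  obtain ⟨r, hr, -, h, -⟩ := exists_radius g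
  rcases lt_or_ge r ‖x‖ with hx | hx
  · simp [h x hx]
  · rw [norm_mul]
    exact (mul_le_mul ((PiLp.norm_apply_le x i).trans (hx.trans hr.le))
      (PiLp.norm_apply_le (g.1 x) j) (norm_nonneg _) zero_le_one).trans (one_mul _).le

/-- The constant vector `v` times a scalar function. -/
noncomputable def scalarMulBall (f : SmoothBall ℝ) : Plane →ₗ[ℝ] SmoothBall Plane where
  toFun v := mapBall (ContinuousLinearMap.toSpanSingleton ℝ v) f
  map_add' v w := Subtype.ext (funext fun x => smul_add (f.1 x) v w)
  map_smul' c v := Subtype.ext (funext fun x => smul_comm (f.1 x) c v)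

theorem scalarMulBall_apply (f : SmoothBall ℝ) (v x : Plane) :
    (scalarMulBall f v).1 x = f.1 x • v := rfl

/-- The momentum projection as a linear operator on smooth fields supported in the ball. -/
noncomputable def momentumProjBall (ι : SmoothBall ℝ) (η : SmoothBall Plane) :
    SmoothBall Plane →ₗ[ℝ] SmoothBall Plane :=
  LinearMap.id - scalarMulBall ι ∘ₗ totalMomentum -
    (firstMoment 0 1 - firstMoment 1 0).smulRight η

theorem momentumProjBall_coe (ι : SmoothBall ℝ) (η g : SmoothBall Plane) :
    (momentumProjBall ι η g).1 = momentumProj ι η g.1 := by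
  funext x
  unfold momentumProj
  rw [angularMomentum_eq]
  rfl

theorem totalMomentum_momentumProjBall {ι : SmoothBall ℝ} {η : SmoothBall Plane}
    (h : IsMomentumPair ι η) (g : SmoothBall Plane) :
    totalMomentum (momentumProjBall ι η g) = 0 := by
  have h1 : ∀ v, totalMomentum (scalarMulBall ι v) = v := fun v => by
    change ∫ x, ι.1 x • v = v
    rw [integral_smul_const, h.mass, one_smul]
  have h2 : totalMomentum η = 0 := h.linear
  simp [momentumProjBall, h1, h2]

/-- The vanishing first moments of `ι` ensure that removing the linear momentum does not change the
angular momentum, which `η` then removes exactly. -/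
theorem angularMomentum_momentumProjBall {ι : SmoothBall ℝ} {η : SmoothBall Plane}
    (h : IsMomentumPair ι η) (g : SmoothBall Plane) :
    angularMomentum (momentumProjBall ι η g).1 = 0 := by
  have h1 : ∀ i j v, firstMoment i j (scalarMulBall ι v) = 0 := fun i j v => by
    rw [firstMoment_apply]
    simp only [scalarMulBall_apply, PiLp.smul_apply, smul_eq_mul, ← mul_assoc]
    rw [integral_mul_const, h.moment i, zero_mul]
  have h2 : firstMoment 0 1 η - firstMoment 1 0 η = 1 := by
    rw [← angularMomentum_eq]; exact h.angular
  rw [angularMomentum_eq, ← LinearMap.sub_apply]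
  simp only [momentumProjBall, LinearMap.sub_apply, LinearMap.id_apply, LinearMap.comp_apply,
    map_sub, LinearMap.smulRight_apply, map_smul, h1, smul_eq_mul]
  linear_combination -(firstMoment 0 1 g - firstMoment 1 0 g) * h2

theorem momentumProjBall_eq_self (ι : SmoothBall ℝ) (η : SmoothBall Plane) {g : SmoothBall Plane}
    (h0 : totalMomentum g = 0) (ha : angularMomentum g.1 = 0) : momentumProjBall ι η g = g := by
  rw [angularMomentum_eq, ← LinearMap.sub_apply] at ha
  simp only [momentumProjBall, LinearMap.sub_apply (_ - _), LinearMap.sub_apply LinearMap.id,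
    LinearMap.smulRight_apply, ha]
  simp [h0]

theorem normL1Plane_smul (c : ℝ) (f : SmoothBall Plane) :
    normL1Plane (c • f).1 = |c| * normL1Plane f.1 := by
  unfold normL1Plane
  rw [← integral_const_mul]
  exact integral_congr_ae (Filter.Eventually.of_forall fun x => norm_smul c (f.1 x))

theorem normL1Plane_momentumProjBall_le (ι : SmoothBall ℝ) (η : SmoothBall Plane) :
    ∃ c : ℝ, 0 ≤ c ∧ ∀ g, normL1Plane (momentumProjBall ι η g).1 ≤ c * normL1Plane g.1 := by
  have hι := normL1Plane_nonneg ι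
  have hη := normL1Plane_nonneg η
  refine ⟨1 + normL1Plane ι.1 + 2 * normL1Plane η.1, by positivity, fun g => ?_⟩
  have h1 : normL1Plane (scalarMulBall ι (totalMomentum g)).1 ≤
      normL1Plane g.1 * normL1Plane ι.1 := by
    refine (normL1Plane_mapBall_le _ ι).trans (mul_le_mul_of_nonneg_right ?_ hι)
    rw [ContinuousLinearMap.norm_toSpanSingleton]
    exact norm_integral_ball_le g
  have h2 : normL1Plane ((firstMoment 0 1 g - firstMoment 1 0 g) • η).1 ≤
      2 * normL1Plane g.1 * normL1Plane η.1 := by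
    rw [normL1Plane_smul]
    refine mul_le_mul_of_nonneg_right ((abs_sub _ _).trans ?_) hη
    linarith [abs_firstMoment_le 0 1 g, abs_firstMoment_le 1 0 g]
  refine (normL1Plane_sub_le _ _).trans ((add_le_add ((normL1Plane_sub_le _ _).trans
    (add_le_add_right h1 _)) h2).trans (le_of_eq ?_))
  simp only [LinearMap.id_apply]
  ring

/-! ### Divergence of symmetric matrix fields -/

/-- The entries of a symmetric matrix, as continuous linear functionals. -/
noncomputable def entrySym (i j : Fin 2) : NormedHom SymMat ℝ :=
  LinearMap.toContinuousLinearMap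
    { toFun := fun A => A.1 i j
      map_add' := fun _ _ => rfl
      map_smul' := fun _ _ => rfl }

theorem entrySym_apply (i j : Fin 2) (A : SymMat) : entrySym i j A = A.1 i j := rfl

theorem entrySym_symm (i j : Fin 2) (A : SymMat) : A.1 i j = A.1 j i := A.2.apply j i

/-- The entries of a symmetric matrix field in the ball. -/
noncomputable def entryBall (i j : Fin 2) : SmoothBall SymMat →ₗ[ℝ] SmoothBall ℝ :=
  mapBall (entrySym i j)

theorem matDiv_apply (S : SmoothBall SymMat) (x : Plane) (i : Fin 2) :
    matDiv S.1 x i = ∑ j, (partialBall j (entryBall i j S)).1 x := rfl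

theorem matDiv_sub (S T : SmoothBall SymMat) : matDiv (S - T).1 = matDiv S.1 - matDiv T.1 := by
  funext x
  ext i
  have h : ∀ j, partialBall j (entryBall i j (S - T)) =
      partialBall j (entryBall i j S) - partialBall j (entryBall i j T) := fun j => by
    rw [map_sub (entryBall i j), map_sub (partialBall j)]
  simp only [Pi.sub_apply, PiLp.sub_apply, matDiv_apply, h, ← Finset.sum_sub_distrib]
  rfl

theorem totalMomentum_of_matDiv {S : SmoothBall SymMat} {g : SmoothBall Plane}
    (h : matDiv S.1 = g.1) : totalMomentum g = 0 := by
  ext i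
  rw [totalMomentum_apply_coord]
  simp only [← h, matDiv_apply]
  rw [integral_finsetSum _ fun j _ => integrable_ball _]
  simp [integral_partialBall]

/-- By parts, the first moments of a divergence are minus the integrals of the matrix entries; the
antisymmetric combination vanishes because the matrix is symmetric. -/
theorem angularMomentum_of_matDiv {S : SmoothBall SymMat} {g : SmoothBall Plane}
    (h : matDiv S.1 = g.1) : angularMomentum g.1 = 0 := by
  have hm : ∀ i j, firstMoment i j g = -∫ x, (S.1 x).1 j i := by
    intro i j
    rw [firstMoment_apply]
    simp only [← h, matDiv_apply, Finset.mul_sum]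
    rw [integral_finsetSum _ fun k _ => integrable_coord_mul i _]
    simp only [integral_coord_mul_partialBall, Finset.sum_ite_eq, Finset.mem_univ, if_true]
    rfl
  rw [angularMomentum_eq, hm, hm]
  simp only [fun x => entrySym_symm 1 0 (S.1 x), sub_self]

/-! ### Solving the divergence equation in the ball

For a field `g` without linear and angular momentum, the symmetric matrix field
`ι(x) ∫ y ⊗ g(y) dy - ∫ w ⊗ w ∫₀¹ ∇ι(x - s w) · g(x + (1 - s) w) ds dw` has divergence `g`. -/

/-- The integral of `∇ι ⊗ g` over the segments through `x` in direction `w`. -/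
noncomputable def segKernel (ι : SmoothBall ℝ) (g : SmoothBall Plane) (x w : Plane) : ℝ :=
  ∫ s in Icc (0 : ℝ) 1, fderiv ℝ ι.1 (x - s • w) (g.1 (x + (1 - s) • w))

theorem contDiff_segKernel_integrand (ι : SmoothBall ℝ) (g : SmoothBall Plane) :
    ContDiff ℝ ∞ (Function.uncurry fun (p : Plane × Plane) (s : ℝ) =>
      fderiv ℝ ι.1 (p.1 - s • p.2) (g.1 (p.1 + (1 - s) • p.2))) := by
  have h1 : ContDiff ℝ ∞ (fderiv ℝ ι.1) := ι.2.1.fderiv_right (by simp)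
  have h2 := g.2.1
  unfold Function.uncurry
  refine (h1.comp ?_).clm_apply (h2.comp ?_) <;> fun_prop

theorem contDiff_segKernel (ι : SmoothBall ℝ) (g : SmoothBall Plane) :
    ContDiff ℝ ∞ (Function.uncurry (segKernel ι g)) :=
  contDiff_setIntegral isCompact_Icc (contDiff_segKernel_integrand ι g)

theorem integrableOn_segKernel (ι : SmoothBall ℝ) (g : SmoothBall Plane) (x w : Plane) :
    IntegrableOn (fun s : ℝ => fderiv ℝ ι.1 (x - s • w) (g.1 (x + (1 - s) • w))) (Icc 0 1) :=
  ((contDiff_segKernel_integrand ι g).continuous.comp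
    (Continuous.prodMk_right (x, w))).continuousOn.integrableOn_compact isCompact_Icc

theorem segKernel_add (ι : SmoothBall ℝ) (g h : SmoothBall Plane) (x w : Plane) :
    segKernel ι (g + h) x w = segKernel ι g x w + segKernel ι h x w := by
  unfold segKernel
  rw [← integral_add (integrableOn_segKernel ι g x w) (integrableOn_segKernel ι h x w)]
  simp only [← map_add]
  rfl

theorem segKernel_smul (ι : SmoothBall ℝ) (c : ℝ) (g : SmoothBall Plane) (x w : Plane) :
    segKernel ι (c • g) x w = c * segKernel ι g x w := by
  unfold segKernel
  rw [← integral_const_mul]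
  simp only [← smul_eq_mul, ← map_smul]
  rfl

/-- Convexity of the ball, since `x` lies on the segment between the two points. It confines the
support of the segment integrals. -/
theorem norm_le_of_segment {x w : Plane} {r s : ℝ} (hs : s ∈ Icc (0 : ℝ) 1)
    (h1 : ‖x - s • w‖ ≤ r) (h2 : ‖x + (1 - s) • w‖ ≤ r) : ‖x‖ ≤ r := by
  have hx : x = (1 - s) • (x - s • w) + s • (x + (1 - s) • w) := by module
  calc ‖x‖ = ‖(1 - s) • (x - s • w) + s • (x + (1 - s) • w)‖ := by rw [← hx]
    _ ≤ (1 - s) * r + s * r := by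
      refine (norm_add_le _ _).trans (add_le_add ?_ ?_)
      · rw [norm_smul, Real.norm_of_nonneg (sub_nonneg.2 hs.2)]
        exact mul_le_mul_of_nonneg_left h1 (sub_nonneg.2 hs.2)
      · rw [norm_smul, Real.norm_of_nonneg hs.1]
        exact mul_le_mul_of_nonneg_left h2 hs.1
    _ = r := by ring

theorem exists_radius_segKernel (ι : SmoothBall ℝ) (g : SmoothBall Plane) :
    ∃ r < 1, (∀ x, r < ‖x‖ → ι.1 x = 0) ∧ ∀ x w s, s ∈ Icc (0 : ℝ) 1 → r < ‖x‖ →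
      ‖fderiv ℝ ι.1 (x - s • w)‖ * ‖g.1 (x + (1 - s) • w)‖ = 0 := by
  obtain ⟨r₁, hr₁, -, hι, hdι⟩ := exists_radius ι
  obtain ⟨r₂, hr₂, -, hg, -⟩ := exists_radius g
  refine ⟨max r₁ r₂, max_lt hr₁ hr₂, fun x hx => hι x ((le_max_left _ _).trans_lt hx),
    fun x w s hs hx => ?_⟩
  by_contra hne
  rw [mul_eq_zero, not_or, norm_eq_zero, norm_eq_zero] at hne
  refine absurd hx (not_lt.2 (norm_le_of_segment (w := w) hs ?_ ?_))
  · exact le_max_of_le_left (not_lt.1 fun h => hne.1 (hdι _ h))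
  · exact le_max_of_le_right (not_lt.1 fun h => hne.2 (hg _ h))

/-- Moving `x` to `x + t w` only shifts the segment parameter, turning the kernel into the integral
of a fixed function `k` over `[-t, 1 - t]`. Its derivative at `t = 0` is `k 0 - k 1`, so no
derivative of `g` appears. -/
theorem fderiv_segKernel (ι : SmoothBall ℝ) (g : SmoothBall Plane) (x w : Plane) :
    fderiv ℝ (fun y => segKernel ι g y w) x w =
      fderiv ℝ ι.1 x (g.1 (x + w)) - fderiv ℝ ι.1 (x - w) (g.1 x) := by
  set k : ℝ → ℝ := fun s => fderiv ℝ ι.1 (x - s • w) (g.1 (x + (1 - s) • w)) with hk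
  have hkc : Continuous k :=
    (contDiff_segKernel_integrand ι g).continuous.comp (Continuous.prodMk_right (x, w))
  have hline : HasDerivAt (fun t : ℝ => segKernel ι g (x + t • w) w)
      (fderiv ℝ (fun y => segKernel ι g y w) x w) 0 := by
    have h1 : HasDerivAt (fun t : ℝ => x + t • w) w 0 := by
      simpa using ((hasDerivAt_id (0 : ℝ)).smul_const w).const_add x
    have h2 : ContDiff ℝ ∞ fun y => segKernel ι g y w :=
      (contDiff_segKernel ι g).comp (contDiff_id.prodMk contDiff_const)
    have h3 : HasFDerivAt (fun y => segKernel ι g y w)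
        (fderiv ℝ (fun y => segKernel ι g y w) x) (x + (0 : ℝ) • w) := by
      rw [zero_smul, add_zero]
      exact (h2.differentiable (by simp) x).hasFDerivAt
    exact h3.comp_hasDerivAt (0 : ℝ) h1
  have hval : ∀ t : ℝ, segKernel ι g (x + t • w) w =
      (∫ s in (0 : ℝ)..(1 - t), k s) - ∫ s in (0 : ℝ)..(0 - t), k s := by
    intro t
    rw [intervalIntegral.integral_interval_sub_left (hkc.intervalIntegrable _ _)
      (hkc.intervalIntegrable _ _), ← intervalIntegral.integral_comp_sub_right k t]
    unfold segKernel
    rw [setIntegral_Icc_eq_interval]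
    refine intervalIntegral.integral_congr fun s _ => ?_
    have e1 : x + t • w - s • w = x - (s - t) • w := by module
    have e2 : x + t • w + (1 - s) • w = x + (1 - (s - t)) • w := by module
    simp only [hk, e1, e2]
  have hprim : ∀ a : ℝ, HasDerivAt (fun t : ℝ => ∫ s in (0 : ℝ)..(a - t), k s) (-k a) 0 := by
    intro a
    have h1 := intervalIntegral.integral_hasDerivAt_right (hkc.intervalIntegrable 0 (a - 0))
      hkc.aestronglyMeasurable.stronglyMeasurableAtFilter hkc.continuousAt
    exact (h1.comp (0 : ℝ) ((hasDerivAt_id (0 : ℝ)).const_sub a)).congr_deriv (by simp)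
  have := hline.unique (((hprim 1).sub (hprim 0)).congr_of_eventuallyEq
    (Filter.Eventually.of_forall hval))
  rw [this]
  simp only [hk, one_smul, zero_smul, sub_self, add_zero, sub_zero]
  ring

/-- The symmetric matrix `w ⊗ w`. -/
noncomputable def dyad (w : Plane) : SymMat :=
  diagSym 0 (w 0 ^ 2) + diagSym 1 (w 1 ^ 2) + offDiagSym (w 0 * w 1)

theorem dyad_apply (w : Plane) (i j : Fin 2) : (dyad w).1 i j = w i * w j := by
  fin_cases i <;> fin_cases j <;>
    simp [dyad, diagSym_apply, offDiagSym_apply, sq, mul_comm]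

theorem contDiff_dyad : ContDiff ℝ ∞ dyad := by
  have h := contDiff_coord
  exact (((diagSym 0).contDiff.comp ((h 0).pow 2)).add
    ((diagSym 1).contDiff.comp ((h 1).pow 2))).add (offDiagSym.contDiff.comp ((h 0).mul (h 1)))

/-- The symmetric matrix of first moments of a field with vanishing angular momentum. -/
noncomputable def symMoment : SmoothBall Plane →ₗ[ℝ] SymMat :=
  (diagSym 0).toLinearMap ∘ₗ firstMoment 0 0 + (diagSym 1).toLinearMap ∘ₗ firstMoment 1 1 +
    offDiagSym.toLinearMap ∘ₗ firstMoment 0 1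

theorem symMoment_eq (g : SmoothBall Plane) : symMoment g = diagSym 0 (firstMoment 0 0 g) +
    diagSym 1 (firstMoment 1 1 g) + offDiagSym (firstMoment 0 1 g) := rfl

theorem symMoment_apply {g : SmoothBall Plane} (h : angularMomentum g.1 = 0) (i j : Fin 2) :
    (symMoment g).1 i j = firstMoment i j g := by
  rw [angularMomentum_eq] at h
  fin_cases i <;> fin_cases j <;> simp [symMoment_eq, diagSym_apply, offDiagSym_apply]
  linarith

theorem contDiff_segIntegrand (ι : SmoothBall ℝ) (g : SmoothBall Plane) :
    ContDiff ℝ ∞ (Function.uncurry fun x w : Plane => segKernel ι g x w • dyad w) :=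
  (contDiff_segKernel ι g).smul (contDiff_dyad.comp contDiff_snd)

theorem integrableOn_closedBall_slice {F : Type*} [NormedAddCommGroup F] [NormedSpace ℝ F]
    {Φ : Plane → Plane → F} (h : ContDiff ℝ ∞ (Function.uncurry Φ)) (x : Plane) (r : ℝ) :
    IntegrableOn (Φ x) (Metric.closedBall 0 r) :=
  (h.continuous.comp
    (Continuous.prodMk_right x)).continuousOn.integrableOn_compact (isCompact_closedBall _ _)

/-- The difference of two operators into smooth functions supported in the ball. -/
noncomputable def subBall {V F : Type*} [AddCommGroup V] [Module ℝ V] [NormedAddCommGroup F]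
    [NormedSpace ℝ F] (S T : V →ₗ[ℝ] SmoothBall F) : V →ₗ[ℝ] SmoothBall F := S - T

theorem subBall_apply {V F : Type*} [AddCommGroup V] [Module ℝ V] [NormedAddCommGroup F]
    [NormedSpace ℝ F] (S T : V →ₗ[ℝ] SmoothBall F) (v : V) : subBall S T v = S v - T v := rfl

/-- The part of the solution operator that integrates over segments. -/
noncomputable def segSolution (ι : SmoothBall ℝ) : SmoothBall Plane →ₗ[ℝ] SmoothBall SymMat where
  -- The two evaluation points differ by `w` and must both lie in the unit ball, so radius `2`
  -- discards nothing and keeps the domain compact.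
  toFun g := ⟨fun x => ∫ w in Metric.closedBall 0 2, segKernel ι g x w • dyad w, by
    obtain ⟨r, hr, -, h⟩ := exists_radius_segKernel ι g
    refine mem_smoothBall_of_radius
      (contDiff_setIntegral (isCompact_closedBall _ _) (contDiff_segIntegrand ι g)) hr fun x hx => ?_
    have h0 : ∀ w, segKernel ι g x w = 0 := fun w => by
      refine setIntegral_eq_zero_of_forall_eq_zero fun s hs => ?_
      rw [← norm_le_zero_iff, ← h x w s hs hx]
      exact ContinuousLinearMap.le_opNorm _ _
    simp only [h0, zero_smul, integral_zero]⟩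
  map_add' g h := Subtype.ext (funext fun x => by
    refine Eq.trans ?_ (integral_add (integrableOn_closedBall_slice (contDiff_segIntegrand ι g) x 2)
      (integrableOn_closedBall_slice (contDiff_segIntegrand ι h) x 2))
    simp only [segKernel_add, add_smul])
  map_smul' c g := Subtype.ext (funext fun x => by
    refine Eq.trans ?_ (integral_smul c fun w => segKernel ι g x w • dyad w)
    simp only [segKernel_smul, mul_smul])

theorem segSolution_apply (ι : SmoothBall ℝ) (g : SmoothBall Plane) (x : Plane) :
    (segSolution ι g).1 x = ∫ w in Metric.closedBall 0 2, segKernel ι g x w • dyad w := rfl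

/-- A constant symmetric matrix times a scalar function. -/
noncomputable def scalarMulSymBall (f : SmoothBall ℝ) : SymMat →ₗ[ℝ] SmoothBall SymMat where
  toFun A := mapBall (ContinuousLinearMap.toSpanSingleton ℝ A : NormedHom ℝ SymMat) f
  map_add' A B := Subtype.ext (funext fun x => smul_add (f.1 x) A B)
  map_smul' c A := Subtype.ext (funext fun x => smul_comm (f.1 x) c A)

/-- The solution operator of the symmetric divergence equation in the ball. -/
noncomputable def ballSolution (ι : SmoothBall ℝ) : SmoothBall Plane →ₗ[ℝ] SmoothBall SymMat :=
  subBall (scalarMulSymBall ι ∘ₗ symMoment) (segSolution ι)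

theorem partialBall_entryBall_segSolution (ι : SmoothBall ℝ) (g : SmoothBall Plane)
    (i j : Fin 2) (x : Plane) :
    (partialBall j (entryBall i j (segSolution ι g))).1 x =
      ∫ w in Metric.closedBall (0 : Plane) 2,
        w i * (w j * fderiv ℝ (fun y => segKernel ι g y w) x (stdVec j)) := by
  have hentry : (entryBall i j (segSolution ι g)).1 =
      fun y => ∫ w in Metric.closedBall (0 : Plane) 2, segKernel ι g y w * (w i * w j) := by
    funext y
    refine ((entrySym i j).integral_comp_comm (integrableOn_closedBall_slice (contDiff_segIntegrand ι g) y 2)).symm.trans ?_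
    simp only [map_smul, entrySym_apply, dyad_apply, smul_eq_mul]
  have hsm : ContDiff ℝ ∞ (Function.uncurry fun x w : Plane => segKernel ι g x w * (w i * w j)) :=
    (contDiff_segKernel ι g).mul (((contDiff_coord i).comp contDiff_snd).mul
      ((contDiff_coord j).comp contDiff_snd))
  change fderiv ℝ (entryBall i j (segSolution ι g)).1 x (stdVec j) = _
  rw [hentry, (hasFDerivAt_setIntegral_of_contDiff (μ := volume)
    (isCompact_closedBall (0 : Plane) 2) hsm x).fderiv, ContinuousLinearMap.integral_apply]
  · refine integral_congr_ae (Filter.Eventually.of_forall fun w => ?_)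
    have h2 : ContDiff ℝ ∞ fun y => segKernel ι g y w :=
      (contDiff_segKernel ι g).comp (contDiff_id.prodMk contDiff_const)
    simp only
    rw [((h2.differentiable (by simp) x).hasFDerivAt.mul_const (w i * w j)).fderiv]
    exact mul_assoc (w i) (w j) _
  · exact ((contDiff_uncurry_fderiv_left hsm).continuous.comp
      (Continuous.prodMk_right x)).continuousOn.integrableOn_compact (isCompact_closedBall _ _)

theorem sum_coord_smul_stdVec (w : Plane) : ∑ j, w j • stdVec j = w := by
  ext i
  fin_cases i <;> simp

theorem apply_eq_sum_coord (L : Plane →L[ℝ] ℝ) (w : Plane) : L w = ∑ j, w j * L (stdVec j) := by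
  conv_lhs => rw [← sum_coord_smul_stdVec w]
  simp only [map_sum, map_smul, smul_eq_mul]

theorem norm_lt_one_of_ne_zero {F : Type*} [NormedAddCommGroup F] [NormedSpace ℝ F]
    (f : SmoothBall F) {x : Plane} (h : f.1 x ≠ 0) : ‖x‖ < 1 := by
  obtain ⟨r, hr, -, h0, -⟩ := exists_radius f
  exact (not_lt.1 fun h' => h (h0 x h')).trans_lt hr

theorem norm_lt_one_of_fderiv_ne_zero (f : SmoothBall ℝ) {x : Plane} (h : fderiv ℝ f.1 x ≠ 0) :
    ‖x‖ < 1 := by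
  obtain ⟨r, hr, -, -, h0⟩ := exists_radius f
  exact (not_lt.1 fun h' => h (h0 x h')).trans_lt hr

/-- Allows the integrals over `‖w‖ ≤ 2` to be extended to the whole plane, where translation
invariance applies. -/
theorem fderiv_apply_eq_zero_of_two_lt {ι : SmoothBall ℝ} {g : SmoothBall Plane} {x y : Plane}
    (h : 2 < ‖x - y‖) : fderiv ℝ ι.1 x (g.1 y) = 0 := by
  by_contra hne
  have h1 : ‖x‖ < 1 := norm_lt_one_of_fderiv_ne_zero ι fun h0 => hne (by rw [h0]; rfl)
  have h2 : ‖y‖ < 1 := norm_lt_one_of_ne_zero g fun h0 => hne (by rw [h0, map_zero])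
  linarith [norm_sub_le x y]

theorem fderiv_apply_eq_sum (f : SmoothBall ℝ) (x v : Plane) :
    fderiv ℝ f.1 x v = ∑ k, v k * (partialBall k f).1 x :=
  apply_eq_sum_coord _ v

/-- With `y = x + w` the factor `w_i` becomes `y_i - x_i`, and the `x_i` part drops out because `g`
has zero total momentum. -/
theorem integral_coord_mul_fderiv_add (ι : SmoothBall ℝ) {g : SmoothBall Plane}
    (h0 : totalMomentum g = 0) (x : Plane) (i : Fin 2) :
    ∫ w in Metric.closedBall (0 : Plane) 2, w i * fderiv ℝ ι.1 x (g.1 (x + w)) =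
      ∑ k, (partialBall k ι).1 x * firstMoment i k g := by
  rw [setIntegral_eq_integral_of_forall_compl_eq_zero fun w hw => by
    rw [fderiv_apply_eq_zero_of_two_lt (by simpa using hw), mul_zero]]
  have hshift := integral_add_left_eq_self (μ := (volume : Measure Plane))
    (fun y => (y i - x i) * fderiv ℝ ι.1 x (g.1 y)) x
  simp only [PiLp.add_apply, add_sub_cancel_left] at hshift
  rw [hshift]
  have hk : ∀ k, ∫ y : Plane, (y i - x i) * g.1 y k = firstMoment i k g := fun k => by
    have h2 : ∫ y, g.1 y k = 0 := by rw [← totalMomentum_apply_coord, h0]; rfl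
    have h3 := integral_sub (integrable_coord_mul i (compBall k g))
      ((integrable_ball (compBall k g)).const_mul (x i))
    rw [integral_const_mul] at h3
    simp only [compBall_apply, h2, mul_zero, sub_zero, ← sub_mul] at h3
    exact h3
  have hint : ∀ k, Integrable fun y : Plane => (y i - x i) * g.1 y k := fun k => by
    simp only [sub_mul]
    exact (integrable_coord_mul i (compBall k g)).sub
      ((integrable_ball (compBall k g)).const_mul (x i))
  simp only [fderiv_apply_eq_sum, Finset.mul_sum, ← mul_assoc]
  rw [integral_finsetSum _ fun k _ => (hint k).mul_const _]
  simp only [integral_mul_const, hk, mul_comm]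

/-- With `z = x - w`, integrating `(x_i - z_i) ∂_kι(z)` by parts gives `δ_ik ∫ ι`, which reproduces
`g` at `x`. -/
theorem integral_coord_mul_fderiv_sub {ι : SmoothBall ℝ} (hι : ∫ x : Plane, ι.1 x = 1)
    (g : SmoothBall Plane) (x : Plane) (i : Fin 2) :
    ∫ w in Metric.closedBall (0 : Plane) 2, w i * fderiv ℝ ι.1 (x - w) (g.1 x) = g.1 x i := by
  rw [setIntegral_eq_integral_of_forall_compl_eq_zero fun w hw => by
    rw [fderiv_apply_eq_zero_of_two_lt (by simpa using hw), mul_zero]]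
  have hshift := integral_sub_left_eq_self (fun z : Plane => (x i - z i) * fderiv ℝ ι.1 z (g.1 x))
    (volume : Measure Plane) x
  simp only [PiLp.sub_apply, sub_sub_cancel] at hshift
  rw [hshift]
  have hint : ∀ k, Integrable fun z : Plane => (x i - z i) * (partialBall k ι).1 z := fun k => by
    simp only [sub_mul]
    exact ((integrable_ball (partialBall k ι)).const_mul (x i)).sub
      (integrable_coord_mul i (partialBall k ι))
  have hk : ∀ k, ∫ z : Plane, (x i - z i) * (partialBall k ι).1 z = if i = k then 1 else 0 :=
    fun k => by
    simp only [sub_mul]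
    rw [integral_sub ((integrable_ball (partialBall k ι)).const_mul (x i))
      (integrable_coord_mul i (partialBall k ι)), integral_const_mul, integral_partialBall,
      integral_coord_mul_partialBall, hι]
    split_ifs <;> simp
  simp only [fderiv_apply_eq_sum, Finset.mul_sum, mul_left_comm _ (g.1 x _)]
  rw [integral_finsetSum _ fun k _ => (hint k).const_mul _]
  simp [integral_const_mul, hk]

/-- The factor `w_j` of `w ⊗ w`, summed against `∂_j`, forms the derivative along `w`, so
`fderiv_segKernel` reduces the divergence to two endpoint integrals. -/
theorem matDiv_segSolution {ι : SmoothBall ℝ} (hι : ∫ x : Plane, ι.1 x = 1)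
    {g : SmoothBall Plane} (h0 : totalMomentum g = 0) (x : Plane) (i : Fin 2) :
    matDiv (segSolution ι g).1 x i =
      ∑ k, (partialBall k ι).1 x * firstMoment i k g - g.1 x i := by
  have hsm : ∀ j : Fin 2, ContDiff ℝ ∞ (Function.uncurry fun x w : Plane =>
      w i * (w j * fderiv ℝ (fun y => segKernel ι g y w) x (stdVec j))) := fun j =>
    ((contDiff_coord i).comp contDiff_snd).mul (((contDiff_coord j).comp contDiff_snd).mul
      ((contDiff_uncurry_fderiv_left (contDiff_segKernel ι g)).clm_apply contDiff_const))
  have hd : ContDiff ℝ ∞ (fderiv ℝ ι.1) := ι.2.1.fderiv_right (by simp)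
  have hg := g.2.1
  have hi : ContDiff ℝ ∞ fun p : Plane × Plane => p.2 i := (contDiff_coord i).comp contDiff_snd
  have hsm1 : ContDiff ℝ ∞ (Function.uncurry fun x w : Plane =>
      w i * fderiv ℝ ι.1 x (g.1 (x + w))) :=
    hi.mul ((hd.comp contDiff_fst).clm_apply (hg.comp (contDiff_fst.add contDiff_snd)))
  have hsm2 : ContDiff ℝ ∞ (Function.uncurry fun x w : Plane =>
      w i * fderiv ℝ ι.1 (x - w) (g.1 x)) :=
    hi.mul ((hd.comp (contDiff_fst.sub contDiff_snd)).clm_apply (hg.comp contDiff_fst))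
  rw [matDiv_apply]
  simp only [partialBall_entryBall_segSolution]
  rw [← integral_finsetSum _ fun j _ => integrableOn_closedBall_slice (hsm j) x 2]
  simp only [← Finset.mul_sum, ← apply_eq_sum_coord, fderiv_segKernel, mul_sub]
  rw [integral_sub (integrableOn_closedBall_slice hsm1 x 2)
    (integrableOn_closedBall_slice hsm2 x 2), integral_coord_mul_fderiv_add ι h0,
    integral_coord_mul_fderiv_sub hι]

/-- Zero angular momentum makes the moment matrix symmetric, so `ι` times this matrix is admissible
and its divergence cancels the moment terms of `matDiv_segSolution`. -/
theorem matDiv_ballSolution {ι : SmoothBall ℝ} (hι : ∫ x : Plane, ι.1 x = 1)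
    {g : SmoothBall Plane} (h0 : totalMomentum g = 0) (ha : angularMomentum g.1 = 0) :
    matDiv (ballSolution ι g).1 = g.1 := by
  have h1 : ∀ x i, matDiv (scalarMulSymBall ι (symMoment g)).1 x i =
      ∑ k, (partialBall k ι).1 x * firstMoment i k g := by
    intro x i
    rw [matDiv_apply]
    refine Finset.sum_congr rfl fun k _ => ?_
    change fderiv ℝ (fun y => ι.1 y * (symMoment g).1 i k) x (stdVec k) = _
    rw [((ι.2.1.differentiable (by simp) x).hasFDerivAt.mul_const _).fderiv, symMoment_apply ha]
    exact mul_comm _ _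
  have h2 : ballSolution ι g = scalarMulSymBall ι (symMoment g) - segSolution ι g := rfl
  rw [h2, matDiv_sub]
  funext x
  ext i
  rw [Pi.sub_apply, PiLp.sub_apply, h1, matDiv_segSolution hι h0]
  ring

/-! ### The `L¹` bound for the solution operator -/

theorem setIntegral_swap_of_continuous {P Q : Type*} [TopologicalSpace P] [MeasurableSpace P]
    [OpensMeasurableSpace P] [SecondCountableTopology P] [T2Space P] [TopologicalSpace Q]
    [MeasurableSpace Q] [OpensMeasurableSpace Q] [T2Space Q] {μ : Measure P} {ν : Measure Q} [SFinite μ] [SFinite ν]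
    [IsFiniteMeasureOnCompacts μ] [IsFiniteMeasureOnCompacts ν]
    {K : Set P} {L : Set Q} (hK : IsCompact K) (hL : IsCompact L) {f : P → Q → ℝ}
    (hf : Continuous (Function.uncurry f)) :
    ∫ x in K, ∫ q in L, f x q ∂ν ∂μ = ∫ q in L, ∫ x in K, f x q ∂μ ∂ν := by
  refine integral_integral_swap ?_
  rw [Measure.prod_restrict]
  exact hf.continuousOn.integrableOn_compact (hK.prod hL)

theorem setIntegral_setIntegral_le_of_forall_le {P Q : Type*} [NormedAddCommGroup P]
    [MeasurableSpace P] [OpensMeasurableSpace P] [SecondCountableTopology P]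
    [NormedAddCommGroup Q] [MeasurableSpace Q] [OpensMeasurableSpace Q] [ProperSpace Q]
    {μ : Measure P} {ν : Measure Q} [SFinite μ] [SFinite ν]
    [IsFiniteMeasureOnCompacts μ] [IsFiniteMeasureOnCompacts ν] [IsLocallyFiniteMeasure μ]
    {K : Set P} {L : Set Q} (hK : IsCompact K) (hL : IsCompact L) {f : P → Q → ℝ}
    (hf : Continuous (Function.uncurry f)) {c : ℝ} (hc : ∀ q, ∫ x in K, f x q ∂μ ≤ c) :
    ∫ x in K, ∫ q in L, f x q ∂ν ∂μ ≤ ν.real L * c := by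
  have hcont : Continuous fun q => ∫ x in K, f x q ∂μ :=
    continuous_parametric_integral_of_continuous (f := fun q x => f x q)
      (hf.comp continuous_swap) hK
  rw [setIntegral_swap_of_continuous hK hL hf, ← smul_eq_mul, ← setIntegral_const]
  exact integral_mono (hcont.continuousOn.integrableOn_compact hL)
    (integrableOn_const hL.measure_lt_top.ne) hc

theorem norm_symMoment_le : ∃ c : ℝ, 0 ≤ c ∧ ∀ g, ‖symMoment g‖ ≤ c * normL1Plane g.1 := by
  refine ⟨‖diagSym 0‖ + ‖diagSym 1‖ + ‖offDiagSym‖, by positivity, fun g => ?_⟩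
  have h : ∀ (L : NormedHom ℝ SymMat) i j, ‖L (firstMoment i j g)‖ ≤ ‖L‖ * normL1Plane g.1 :=
    fun L i j => (L.le_opNorm _).trans
      (mul_le_mul_of_nonneg_left (abs_firstMoment_le i j g) (norm_nonneg _))
  rw [symMoment_eq, add_mul, add_mul]
  exact norm_add₃_le.trans (add_le_add (add_le_add (h _ 0 0) (h _ 1 1)) (h _ 0 1))

/-- For fixed `w` and `s` integrate in `x` first: `∇ι` is bounded and a translate of `g` has the
same `L¹` norm. The remaining integrals run over sets of finite measure. -/
theorem normL1Plane_segSolution_le (ι : SmoothBall ℝ) :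
    ∃ c : ℝ, 0 ≤ c ∧ ∀ g, normL1Plane (segSolution ι g).1 ≤ c * normL1Plane g.1 := by
  have hB := isCompact_closedBall (0 : Plane) 2
  obtain ⟨c₁, hc₁⟩ := hB.exists_bound_of_continuousOn contDiff_dyad.continuous.continuousOn
  obtain ⟨c₂, hc₂⟩ := (ι.2.1.continuous_fderiv (by simp)).bounded_above_of_compact_support
    (ι.2.2.1.fderiv ℝ)
  have hc₁0 : 0 ≤ c₁ := (norm_nonneg _).trans (hc₁ 0 (by simp))
  have hc₂0 : 0 ≤ c₂ := (norm_nonneg _).trans (hc₂ 0)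
  set V := (volume : Measure Plane).real (Metric.closedBall 0 2)
  refine ⟨V * c₂ * c₁, by positivity, fun g => ?_⟩
  have hdc := ι.2.1.continuous_fderiv (by simp)
  have hgc := continuous_ball g
  set N : Plane → Plane → ℝ → ℝ := fun x w s =>
    ‖fderiv ℝ ι.1 (x - s • w)‖ * ‖g.1 (x + (1 - s) • w)‖ * c₁ with hN
  have hNc : Continuous fun p : (Plane × Plane) × ℝ => N p.1.1 p.1.2 p.2 := by
    simp only [hN]
    fun_prop
  have hJ : Continuous (Function.uncurry fun x w : Plane => ∫ s in Icc (0 : ℝ) 1, N x w s) :=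
    continuous_parametric_integral_of_continuous
      (f := fun (p : Plane × Plane) s => N p.1 p.2 s) hNc isCompact_Icc
  have hpt : ∀ x, ‖(segSolution ι g).1 x‖ ≤
      ∫ w in Metric.closedBall (0 : Plane) 2, ∫ s in Icc (0 : ℝ) 1, N x w s := by
    intro x
    rw [segSolution_apply]
    refine norm_integral_le_of_norm_le ?_
      ((ae_restrict_iff' hB.measurableSet).2 (Filter.Eventually.of_forall fun w hw => ?_))
    · exact (hJ.comp (Continuous.prodMk_right x)).continuousOn.integrableOn_compact hB
    · rw [norm_smul]
      simp only [hN]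
      rw [integral_mul_const]
      refine mul_le_mul ?_ (hc₁ w hw) (norm_nonneg _)
        (integral_nonneg fun s => by positivity)
      refine norm_integral_le_of_norm_le ?_
        (Filter.Eventually.of_forall fun s => ContinuousLinearMap.le_opNorm _ _)
      refine Continuous.continuousOn ?_ |>.integrableOn_compact isCompact_Icc
      fun_prop
  have hsupp : normL1Plane (segSolution ι g).1 =
      ∫ x in Metric.closedBall (0 : Plane) 1, ‖(segSolution ι g).1 x‖ := by
    refine (setIntegral_eq_integral_of_forall_compl_eq_zero fun x hx => ?_).symm
    by_contra hne
    exact hx (by simpa using (norm_lt_one_of_ne_zero _ (norm_ne_zero_iff.1 hne)).le)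
  have hK := isCompact_closedBall (0 : Plane) 1
  have hinner : ∀ w s, ∫ x in Metric.closedBall (0 : Plane) 1, N x w s ≤
      c₂ * c₁ * normL1Plane g.1 := by
    intro w s
    have hgi : Integrable fun x => ‖g.1 (x + (1 - s) • w)‖ :=
      (integrable_ball g).norm.comp_add_right _
    calc ∫ x in Metric.closedBall (0 : Plane) 1, N x w s
        ≤ ∫ x in Metric.closedBall (0 : Plane) 1, c₂ * c₁ * ‖g.1 (x + (1 - s) • w)‖ := by
          refine integral_mono ?_ (hgi.integrableOn.const_mul _) fun x => ?_
          · refine Continuous.continuousOn ?_ |>.integrableOn_compact hK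
            simp only [hN]
            fun_prop
          · simp only [hN]
            rw [mul_right_comm]
            exact mul_le_mul_of_nonneg_right
              (mul_le_mul_of_nonneg_right (hc₂ _) hc₁0) (norm_nonneg _)
      _ ≤ ∫ x, c₂ * c₁ * ‖g.1 (x + (1 - s) • w)‖ :=
          setIntegral_le_integral (hgi.const_mul _)
            (Filter.Eventually.of_forall fun x => by positivity)
      _ = c₂ * c₁ * normL1Plane g.1 := by
          rw [integral_const_mul, integral_add_right_eq_self fun x => ‖g.1 x‖]
          rfl
  have hmid : ∀ w, ∫ x in Metric.closedBall (0 : Plane) 1, ∫ s in Icc (0 : ℝ) 1, N x w s ≤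
      c₂ * c₁ * normL1Plane g.1 := by
    intro w
    have hNw : Continuous (Function.uncurry fun (x : Plane) (s : ℝ) => N x w s) := by
      simp only [hN, Function.uncurry_def]
      fun_prop
    refine (setIntegral_setIntegral_le_of_forall_le hK isCompact_Icc hNw (hinner w)).trans ?_
    simp
  calc normL1Plane (segSolution ι g).1
      ≤ ∫ x in Metric.closedBall (0 : Plane) 1,
          ∫ w in Metric.closedBall (0 : Plane) 2, ∫ s in Icc (0 : ℝ) 1, N x w s := by
        rw [hsupp]
        exact integral_mono (integrable_ball _).norm.integrableOn
          ((continuous_parametric_integral_of_continuous hJ hB).continuousOn.integrableOn_compact hK)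
          hpt
    _ ≤ V * (c₂ * c₁ * normL1Plane g.1) :=
        setIntegral_setIntegral_le_of_forall_le hK hB hJ hmid
    _ = V * c₂ * c₁ * normL1Plane g.1 := by ring

theorem normL1Plane_ballSolution_le (ι : SmoothBall ℝ) :
    ∃ c : ℝ, 0 ≤ c ∧ ∀ g, normL1Plane (ballSolution ι g).1 ≤ c * normL1Plane g.1 := by
  obtain ⟨c₁, hc₁, h₁⟩ := norm_symMoment_le
  obtain ⟨c₂, hc₂, h₂⟩ := normL1Plane_segSolution_le ι
  have hι := normL1Plane_nonneg ι
  refine ⟨c₁ * normL1Plane ι.1 + c₂, by positivity, fun g => ?_⟩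
  have h3 : normL1Plane (scalarMulSymBall ι (symMoment g)).1 ≤
      c₁ * normL1Plane g.1 * normL1Plane ι.1 := by
    refine (normL1Plane_mapBall_le _ ι).trans (mul_le_mul_of_nonneg_right ?_ hι)
    exact (ContinuousLinearMap.norm_toSpanSingleton (symMoment g)).trans_le (h₁ g)
  refine (normL1Plane_sub_le _ _).trans ((add_le_add h3 (h₂ g)).trans (le_of_eq ?_))
  ring

/-! ### The improved antidivergence operators -/

/-- The `k`-th column of a symmetric matrix field on the torus. -/
noncomputable def colTorus (k : Fin 2) : SmoothTorus SymMat →ₗ[ℝ] SmoothTorus Plane :=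
  mapTorusLin (symCol k)

theorem symCol_bound : ∃ c : ℝ, 0 ≤ c ∧ ∀ (k : Fin 2) (T : SmoothTorus SymMat),
    normL1Torus (mapTorus (symCol k) T).1 ≤ c * normL1Torus T.1 := by
  let L : Fin 2 → NormedHom SymMat Plane := symCol
  refine ⟨∑ k, ‖L k‖, Finset.sum_nonneg fun _ _ => norm_nonneg _, fun k T => ?_⟩
  refine (normL1Torus_mapTorus_le (L k) T).trans (mul_le_mul_of_nonneg_right ?_
    (normL1Torus_nonneg _))
  exact Finset.single_le_sum (f := fun k => ‖L k‖) (fun _ _ => norm_nonneg _) (Finset.mem_univ k)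

/-- The field `A ∇f` for a symmetric matrix field `A` on the torus. -/
noncomputable def gradField : SmoothBall ℝ →ₗ[ℝ] SmoothTorus SymMat →ₗ[ℝ] SmoothBall Plane :=
  (mulBall ∘ₗ partialBall 0).compl₂ (colTorus 0) + (mulBall ∘ₗ partialBall 1).compl₂ (colTorus 1)

theorem gradField_eq (f : SmoothBall ℝ) (A : SmoothTorus SymMat) :
    gradField f A = mulBall (partialBall 0 f) (colTorus 0 A) +
      mulBall (partialBall 1 f) (colTorus 1 A) := rfl

theorem matDiv_mulBall (f : SmoothBall ℝ) (A : SmoothTorus SymMat) (x : Plane) :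
    matDiv (mulBall f A).1 x = f.1 x • matDiv A.1 x + (gradField f A).1 x := by
  have hA : ∀ i j, DifferentiableAt ℝ (fun y => (A.1 y).1 i j) x := fun i j =>
    ((entrySym i j).contDiff.comp A.2.1).differentiable (by simp) x
  have hf : DifferentiableAt ℝ f.1 x := f.2.1.differentiable (by simp) x
  have hprod : ∀ i j, fderiv ℝ (fun y => ((mulBall f A).1 y).1 i j) x (stdVec j) =
      f.1 x * fderiv ℝ (fun y => (A.1 y).1 i j) x (stdVec j) +
        (A.1 x).1 i j * fderiv ℝ f.1 x (stdVec j) := fun i j => by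
    have h := HasFDerivAt.fderiv (f := fun y => ((mulBall f A).1 y).1 i j)
      (hf.hasFDerivAt.mul (hA i j).hasFDerivAt)
    rw [h]
    rfl
  ext i
  have h1 : (gradField f A).1 x i = fderiv ℝ f.1 x (stdVec 0) * (A.1 x).1 i 0 +
      fderiv ℝ f.1 x (stdVec 1) * (A.1 x).1 i 1 := rfl
  rw [PiLp.add_apply, PiLp.smul_apply, h1]
  change ∑ j, fderiv ℝ (fun y => ((mulBall f A).1 y).1 i j) x (stdVec j) =
    f.1 x * (∑ j, fderiv ℝ (fun y => (A.1 y).1 i j) x (stdVec j)) + _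
  simp only [hprod, Fin.sum_univ_two]
  ring

theorem normL1Plane_gradField_le : ∃ c : ℝ, 0 ≤ c ∧ ∀ f A,
    normL1Plane (gradField f A).1 ≤ c * normW1Inf f.1 * normL1Torus A.1 := by
  obtain ⟨c, hc, h⟩ := symCol_bound
  -- Two partial derivatives, each with the factor `4` from the covering by cells.
  refine ⟨8 * c, by positivity, fun f A => ?_⟩
  have hk : ∀ k, normL1Plane (mulBall (partialBall k f) (colTorus k A)).1 ≤
      4 * normW1Inf f.1 * (c * normL1Torus A.1) := fun k =>
    (normL1Plane_mulBall_le _ _ (ae_norm_partialBall_le f k)).trans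
      (mul_le_mul_of_nonneg_left (h k A) (mul_nonneg zero_le_four (normW1Inf_nonneg _)))
  rw [gradField_eq]
  refine (normL1Plane_add_le _ _).trans ((add_le_add (hk 0) (hk 1)).trans (le_of_eq ?_))
  ring

/-- The difference of two bilinear operators into smooth functions supported in the ball. -/
noncomputable def subBilin {V W F : Type*} [AddCommGroup V] [Module ℝ V] [AddCommGroup W]
    [Module ℝ W] [NormedAddCommGroup F] [NormedSpace ℝ F]
    (S T : V →ₗ[ℝ] W →ₗ[ℝ] SmoothBall F) : V →ₗ[ℝ] W →ₗ[ℝ] SmoothBall F where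
  toFun v := subBall (S v) (T v)
  map_add' v v' := LinearMap.ext fun w => by
    simp only [subBall_apply, map_add, LinearMap.add_apply, add_sub_add_comm]
  map_smul' c v := LinearMap.ext fun w => by
    simp only [subBall_apply, map_smul, LinearMap.smul_apply, smul_sub, RingHom.id_apply]

/-- The antidivergence of `ℙ_X (f u)` in the ball, from an operator `D` on the torus. -/
noncomputable def ballAntidiv (ι : SmoothBall ℝ) (η : SmoothBall Plane) (D : TorusOperator) :
    SmoothBall ℝ →ₗ[ℝ] SmoothTorus Plane →ₗ[ℝ] SmoothBall SymMat :=
  subBilin (mulBall.compl₂ D)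
    ((gradField.compl₂ D).compr₂ (ballSolution ι ∘ₗ momentumProjBall ι η))

theorem ballAntidiv_apply (ι : SmoothBall ℝ) (η : SmoothBall Plane) (D : TorusOperator)
    (f : SmoothBall ℝ) (u : SmoothTorus Plane) :
    ballAntidiv ι η D f u =
      mulBall f (D u) - ballSolution ι (momentumProjBall ι η (gradField f (D u))) := rfl

/-- The field `f u + (Du)∇f` is the divergence of `f Du`, hence unchanged by the momentum
projection. Linearity of the projection then leaves only its value on `f u` once the correction is
subtracted. -/
theorem matDiv_ballAntidiv {ι : SmoothBall ℝ} {η : SmoothBall Plane} (h : IsMomentumPair ι η)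
    {D : TorusOperator} (hD : IsTorusAntidivergence D) (f : SmoothBall ℝ) (u : SmoothTorus Plane) :
    matDiv (ballAntidiv ι η D f u).1 = (momentumProjBall ι η (mulBall f u)).1 := by
  have h1 : matDiv (mulBall f (D u)).1 = (mulBall f u + gradField f (D u)).1 := by
    funext x
    rw [matDiv_mulBall, hD u]
    rfl
  rw [ballAntidiv_apply, matDiv_sub, matDiv_ballSolution h.mass
    (totalMomentum_momentumProjBall h _) (angularMomentum_momentumProjBall h _), h1,
    ← momentumProjBall_eq_self ι η (totalMomentum_of_matDiv h1) (angularMomentum_of_matDiv h1),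
    map_add]
  exact add_sub_cancel_right _ _

/-- The operator `D` enters only through the field `D u`, so the constant is uniform in `D`. -/
theorem normL1Plane_ballAntidiv_le (ι : SmoothBall ℝ) (η : SmoothBall Plane) :
    ∃ c : ℝ, 0 ≤ c ∧ ∀ (D : TorusOperator) f u,
      normL1Plane (ballAntidiv ι η D f u).1 ≤ c * normW1Inf f.1 * normL1Torus (D u).1 := by
  obtain ⟨c₁, hc₁, h₁⟩ := normL1Plane_ballSolution_le ι
  obtain ⟨c₂, hc₂, h₂⟩ := normL1Plane_momentumProjBall_le ι η
  obtain ⟨c₃, hc₃, h₃⟩ := normL1Plane_gradField_le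
  refine ⟨4 + c₁ * (c₂ * c₃), by positivity, fun D f u => ?_⟩
  have h4 := normL1Plane_mulBall_le f (D u) (ae_norm_le_normW1Inf f)
  have h5 : normL1Plane (ballSolution ι (momentumProjBall ι η (gradField f (D u)))).1 ≤
      c₁ * (c₂ * (c₃ * normW1Inf f.1 * normL1Torus (D u).1)) :=
    (h₁ _).trans (mul_le_mul_of_nonneg_left
      ((h₂ _).trans (mul_le_mul_of_nonneg_left (h₃ _ _) hc₂)) hc₁)
  refine (normL1Plane_sub_le _ _).trans ((add_le_add h4 h5).trans (le_of_eq ?_))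
  ring

/-- The antidivergence of `ℙ_X (T f)` in the ball, column by column. -/
noncomputable def ballAntidivMat (ι : SmoothBall ℝ) (η : SmoothBall Plane) (D : TorusOperator) :
    SmoothBall Plane →ₗ[ℝ] SmoothTorus SymMat →ₗ[ℝ] SmoothBall SymMat :=
  (ballAntidiv ι η D ∘ₗ compBall 0).compl₂ (colTorus 0) +
    (ballAntidiv ι η D ∘ₗ compBall 1).compl₂ (colTorus 1)

theorem ballAntidivMat_apply (ι : SmoothBall ℝ) (η : SmoothBall Plane) (D : TorusOperator)
    (f : SmoothBall Plane) (T : SmoothTorus SymMat) :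
    ballAntidivMat ι η D f T = ballAntidiv ι η D (compBall 0 f) (colTorus 0 T) +
      ballAntidiv ι η D (compBall 1 f) (colTorus 1 T) := rfl

theorem matDiv_add (S T : SmoothBall SymMat) : matDiv (S + T).1 = matDiv S.1 + matDiv T.1 := by
  have h := matDiv_sub (S + T) T
  have hS : S + T - T = S := add_sub_cancel_right S T
  rw [← sub_eq_iff_eq_add, ← h, hS]

theorem matDiv_ballAntidivMat {ι : SmoothBall ℝ} {η : SmoothBall Plane} (h : IsMomentumPair ι η)
    {D : TorusOperator} (hD : IsTorusAntidivergence D) (f : SmoothBall Plane)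
    (T : SmoothTorus SymMat) :
    matDiv (ballAntidivMat ι η D f T).1 = momentumProj ι η (matMulVec T.1 f.1) := by
  have h1 : matMulVec T.1 f.1 = (mulBall (compBall 0 f) (colTorus 0 T) +
      mulBall (compBall 1 f) (colTorus 1 T)).1 := by
    funext x
    ext i
    have h2 : matMulVec T.1 f.1 x i = ∑ k, (T.1 x).1 i k * f.1 x k := rfl
    rw [h2, Fin.sum_univ_two, mul_comm, mul_comm ((T.1 x).1 i 1)]
    rfl
  rw [ballAntidivMat_apply, matDiv_add, matDiv_ballAntidiv h hD, matDiv_ballAntidiv h hD, h1,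
    ← momentumProjBall_coe, map_add]
  rfl

theorem normW1Inf_compBall_le (k : Fin 2) (f : SmoothBall Plane) :
    normW1Inf (compBall k f).1 ≤ normW1Inf f.1 := by
  refine normW1Inf_comp_le f _ (ContinuousLinearMap.opNorm_le_bound _ zero_le_one fun x => ?_)
  rw [one_mul]
  exact PiLp.norm_apply_le x k

theorem mainTheorem7 (ι : SmoothBall ℝ) (η : SmoothBall Plane) (hιη : IsMomentumPair ι η) :
    (∃ D : TorusOperator, IsTorusAntidivergence D ∧ ∃ K : ℝ, HasOscillationBound D K) ∧
    ∃ C : ℝ, 0 < C ∧ ∀ D : TorusOperator, IsTorusAntidivergence D →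
      (∃ R : SmoothBall ℝ →ₗ[ℝ] SmoothTorus Plane →ₗ[ℝ] SmoothBall SymMat,
        (∀ f u, matDiv (R f u).1 = momentumProj ι η (fun x => f.1 x • u.1 x)) ∧
        (∀ f u, normL1Plane (R f u).1 ≤ C * normW1Inf f.1 * normL1Torus (D u).1) ∧
        (∀ K : ℝ, HasOscillationBound D K → ∀ (n : ℕ+) f u,
          normL1Plane (R f (oscillate n u)).1 ≤
            C * K / (n : ℝ) * normW1Inf f.1 * normL1Torus u.1)) ∧
      (∃ R' : SmoothBall Plane →ₗ[ℝ] SmoothTorus SymMat →ₗ[ℝ] SmoothBall SymMat,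
        (∀ f T, matDiv (R' f T).1 = momentumProj ι η (matMulVec T.1 f.1)) ∧
        (∀ f T, normL1Plane (R' f T).1 ≤
          C * normW1Inf f.1 * ∑ k : Fin 2, normL1Torus (D (mapTorus (symCol k) T)).1) ∧
        (∀ K : ℝ, HasOscillationBound D K → ∀ (n : ℕ+) f T,
          normL1Plane (R' f (oscillate n T)).1 ≤
            C * K / (n : ℝ) * normW1Inf f.1 * normL1Torus T.1)) := by
  refine ⟨exists_torusAntidivergence_oscillationBound, ?_⟩
  obtain ⟨c, hc, hR⟩ := normL1Plane_ballAntidiv_le ι η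
  obtain ⟨d, hd, hcol⟩ := symCol_bound
  have hR' : ∀ D f T, normL1Plane (ballAntidivMat ι η D f T).1 ≤
      c * normW1Inf f.1 * ∑ k : Fin 2, normL1Torus (D (mapTorus (symCol k) T)).1 := by
    intro D f T
    have hk : ∀ k, normL1Plane (ballAntidiv ι η D (compBall k f) (colTorus k T)).1 ≤
        c * normW1Inf f.1 * normL1Torus (D (mapTorus (symCol k) T)).1 := fun k =>
      (hR D _ _).trans (mul_le_mul_of_nonneg_right
        (mul_le_mul_of_nonneg_left (normW1Inf_compBall_le k f) hc) (normL1Torus_nonneg _))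
    rw [Fin.sum_univ_two, mul_add]
    exact (normL1Plane_add_le _ _).trans (add_le_add (hk 0) (hk 1))
  -- One constant has to serve every bound: `c` for the direct ones, `2 c d` for the oscillating
  -- matrix bound (two columns, each costing `d`), and `1` for strict positivity.
  have hC₁ : c ≤ c * (1 + 2 * d) + 1 := by nlinarith [mul_nonneg hc hd]
  have hC₂ : c * (2 * d) ≤ c * (1 + 2 * d) + 1 := by nlinarith
  refine ⟨c * (1 + 2 * d) + 1, by positivity, fun D hD =>
    ⟨⟨ballAntidiv ι η D, fun f u => ?_, fun f u => ?_, fun K hK n f u => ?_⟩,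
      ballAntidivMat ι η D, matDiv_ballAntidivMat hιη hD, fun f T => ?_, fun K hK n f T => ?_⟩⟩
  · rw [matDiv_ballAntidiv hιη hD, momentumProjBall_coe]
    rfl
  · have h1 := normL1Torus_nonneg (D u).1
    have h2 := normW1Inf_nonneg f.1
    refine (hR D f u).trans ?_
    gcongr
  · have h1 := normL1Torus_nonneg u.1
    have h2 := normW1Inf_nonneg f.1
    have hK0 := hK.1
    calc normL1Plane (ballAntidiv ι η D f (oscillate n u)).1
        ≤ c * normW1Inf f.1 * (K / (n : ℝ) * normL1Torus u.1) :=
          (hR D f _).trans (mul_le_mul_of_nonneg_left (hK.2 n u) (mul_nonneg hc h2))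
      _ = c * (K / (n : ℝ) * normW1Inf f.1 * normL1Torus u.1) := by ring
      _ ≤ (c * (1 + 2 * d) + 1) * (K / (n : ℝ) * normW1Inf f.1 * normL1Torus u.1) := by gcongr
      _ = _ := by ring
  · have h1 : 0 ≤ ∑ k : Fin 2, normL1Torus (D (mapTorus (symCol k) T)).1 :=
      Finset.sum_nonneg fun k _ => normL1Torus_nonneg _
    have h2 := normW1Inf_nonneg f.1
    refine (hR' D f T).trans ?_
    gcongr
  · have h1 := normL1Torus_nonneg T.1
    have h2 := normW1Inf_nonneg f.1
    have hK0 := hK.1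
    -- Taking a column commutes with oscillation by definition, so `(*)` applies to each column of
    -- `T`.
    have hk : ∀ k : Fin 2, normL1Torus (D (mapTorus (symCol k) (oscillate n T))).1 ≤
        K / (n : ℝ) * (d * normL1Torus T.1) := fun k =>
      (hK.2 n (mapTorus (symCol k) T)).trans
        (mul_le_mul_of_nonneg_left (hcol k T) (by positivity))
    calc normL1Plane (ballAntidivMat ι η D f (oscillate n T)).1
        ≤ c * normW1Inf f.1 * ∑ _k : Fin 2, K / (n : ℝ) * (d * normL1Torus T.1) :=
          (hR' D f _).trans (mul_le_mul_of_nonneg_left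
            (Finset.sum_le_sum fun k _ => hk k) (mul_nonneg hc h2))
      _ = c * (2 * d) * (K / (n : ℝ) * normW1Inf f.1 * normL1Torus T.1) := by
          rw [Fin.sum_univ_two]
          ring
      _ ≤ (c * (1 + 2 * d) + 1) * (K / (n : ℝ) * normW1Inf f.1 * normL1Torus T.1) := by gcongr
      _ = _ := by ring
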